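/- Let $A$ be a finite set. A (two-dimensional) configuration is a map $c:\mathbb{Z}^2\to A$; its translate by $\mathbf{t}\in\mathbb{Z}^2$ is the configuration $\tau^{\mathbf t}(c)$ with $\tau^{\mathbf t}(c)(\mathbf n)=c(\mathbf n-\mathbf t)$ for all $\mathbf n\in\mathbb{Z}^2$. A configuration $c$ is called periodic if $\tau^{\mathbf t}(c)=c$ for some $\mathbf t\in\mathbb{Z}^2\setminus\{\mathbf 0\}$. The orbit closure $\overline{\mathcal O(c)}$ is the closure of $\{\tau^{\mathbf t}(c) : \mathbf t\in\mathbb{Z}^2\}$ in $A^{\mathbb{Z}^2}$ with the product of the discrete topologies on $A$. Theorem. Let $c\in A^{\mathbb{Z}^2}$ be a configuration that has low complexity with respect to a rectangle, that is, for some natural numbers $n,m$ and $D=\{1,\dots,n\}\times\{1,\dots,m\}$, the set $\{\tau^{\mathbf t}(c)|_D : \mathbf t\in\mathbb{Z}^2\}$ of $D$-patterns of $c$ has at most $|D|=nm$ elements. Then $\overline{\mathcal O(c)}$ contains a periodic configuration. -/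

import Mathlib

namespace Grid

/-- A two-dimensional configuration over the alphabet `A`: a coloring of `ℤ²`.
As a function type it carries the product topology. -/
abbrev Config (A : Type*) := ℤ × ℤ → A

/-- The translation by the vector `t`: the color of cell `n` in the translate is the
color of cell `n - t` in `c`. -/
def translate {A : Type*} (t : ℤ × ℤ) (c : Config A) : Config A :=
  fun n => c (n - t)

/-- `c` is periodic: some non-zero translation fixes it. -/
def IsPeriodic {A : Type*} (c : Config A) : Prop :=
  ∃ t : ℤ × ℤ, t ≠ 0 ∧ translate t c = c

/-- The set of patterns with domain `D` that appear in `c`: the restrictions to `D`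
of all translates of `c`. -/
def patterns {A : Type*} (c : Config A) (D : Finset (ℤ × ℤ)) : Set (D → A) :=
  {p | ∃ t : ℤ × ℤ, p = fun x : D => translate t c x.1}

/-- `c` has low complexity with respect to the finite shape `D`: the number of distinct
`D`-patterns of `c` is at most the number of cells of `D`. -/
def LowComplexity {A : Type*} (c : Config A) (D : Finset (ℤ × ℤ)) : Prop :=
  (patterns c D).encard ≤ (D.card : ℕ∞)

/-- The rectangle `{1, …, n} × {1, …, m}` of cells. -/
noncomputable def rectangle (n m : ℕ) : Finset (ℤ × ℤ) :=
  Finset.Icc (1 : ℤ) (n : ℤ) ×ˢ Finset.Icc (1 : ℤ) (m : ℤ)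

/-- The orbit of `c`: the set of all its translates. -/
def orbit {A : Type*} (c : Config A) : Set (Config A) :=
  {d | ∃ t : ℤ × ℤ, d = translate t c}

/-- The orbit closure of `c`, in the product topology. -/
def orbitClosure {A : Type*} [TopologicalSpace A] (c : Config A) : Set (Config A) :=
  closure (orbit c)

end Grid

/-! Low complexity is first turned into algebra. Encode the colors injectively as bounded integers.
If a shape has at most as many patterns as cells, then its cells satisfy a non-trivial integer
affine relation, so that after one extra difference the configuration is annihilated by a non-zero
Laurent polynomial `f`. Since `f(X)^p ≡ f(X^p)` mod `p`, boundedness makes `f(X^p)` an annihilator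
for every large prime `p`, and combining such dilations produces an annihilating product of
difference operators (`exists_diffs_eq_zero`).

Inside the orbit closure take a minimal subshift `X`. If `X` is infinite, compactness yields two
distinct elements that agree on an open half-plane (`exists_asymptotic_pair`). On their difference
all operators transversal to the boundary cancel, so some operator is parallel to it: the boundary
direction is rational and may be taken horizontal. The parallel operators show that differences of
such pairs are horizontally periodic with a uniform period. With minimality, this forces asymptotic
pairs on one side to coexist with pairs on the other side (`AsymptoticBelow.above`).

Now take a smallest convex shape `S` with at most `|S|` patterns. If its top row is not longer than
its bottom row, an asymptotic pair restricts the patterns of `S` without its top row so strongly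
that every row of a strip is periodic. The affine relation carries this period upwards, and a limit
of upward shifts is periodic (`IsGenerating.exists_isPeriodic`). If the top row is longer, the
reflected picture applies, and it has the asymptotic pair it needs because both sides occur. -/

namespace Grid
open AddMonoidAlgebra

/-! ### Laurent polynomial annihilators and the Frobenius trick -/

/-- The difference operator in direction `w`. -/
def diff (w : ℤ × ℤ) (y : Config ℤ) : Config ℤ := fun n => y (n + w) - y n

/-- The composition of the difference operators of a list of vectors. -/
def diffs (W : List (ℤ × ℤ)) (y : Config ℤ) : Config ℤ := W.foldr diff y

/-- The action of `ℤ²` on integer configurations by shifts, as a monoid homomorphism. -/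
noncomputable def shiftHom : Multiplicative (ℤ × ℤ) →* Module.End ℤ (Config ℤ) where
  toFun v :=
    { toFun := fun y n => y (n + v.toAdd)
      map_add' := fun _ _ => rfl
      map_smul' := fun _ _ => rfl }
  map_one' := by
    ext y n
    simp
  map_mul' v w := by
    ext y n
    simp [add_assoc]

/-- The action of Laurent polynomials on integer configurations. -/
noncomputable def act : AddMonoidAlgebra ℤ (ℤ × ℤ) →ₐ[ℤ] Module.End ℤ (Config ℤ) :=
  AddMonoidAlgebra.lift ℤ _ _ shiftHom

theorem act_single (v : ℤ × ℤ) (a : ℤ) (y : Config ℤ) (n : ℤ × ℤ) :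
    act (single v a) y n = a * y (n + v) := by
  simp [act, AddMonoidAlgebra.lift_single, shiftHom]

theorem act_sum {ι : Type*} (s : Finset ι) (v : ι → ℤ × ℤ) (a : ι → ℤ) (y : Config ℤ)
    (n : ℤ × ℤ) :
    act (∑ i ∈ s, single (v i) (a i)) y n = ∑ i ∈ s, a i * y (n + v i) := by
  simp [map_sum, LinearMap.sum_apply, Finset.sum_apply, act_single]

theorem act_mul (f g : AddMonoidAlgebra ℤ (ℤ × ℤ)) (y : Config ℤ) :
    act (f * g) y = act f (act g y) := by
  simp

/-- Frobenius modulo `p`: mixed terms of a `p`-th power are divisible by `p`, and Fermat's little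
theorem restores the coefficients. -/
theorem exists_sum_single_pow {ι : Type*} (s : Finset ι) (v : ι → ℤ × ℤ) (a : ι → ℤ)
    {p : ℕ} (hp : p.Prime) :
    ∃ g : AddMonoidAlgebra ℤ (ℤ × ℤ), (∑ i ∈ s, single (v i) (a i)) ^ p =
      ∑ i ∈ s, single (p • v i) (a i) + (p : AddMonoidAlgebra ℤ (ℤ × ℤ)) * g := by
  classical
  induction s using Finset.induction_on with
  | empty => exact ⟨0, by simp [hp.ne_zero]⟩
  | insert i s hi ih =>
    obtain ⟨g, hg⟩ := ih
    obtain ⟨r, hr⟩ := exists_add_pow_prime_eq hp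
      (single (v i) (a i) : AddMonoidAlgebra ℤ (ℤ × ℤ)) (∑ i ∈ s, single (v i) (a i))
    have hfermat : (p : ℤ) ∣ a i ^ p - a i := by
      have := Fact.mk hp
      rw [← ZMod.intCast_zmod_eq_zero_iff_dvd]
      push_cast
      rw [ZMod.pow_card, sub_self]
    obtain ⟨b, hb⟩ := hfermat
    have hs : (single (v i) (a i) : AddMonoidAlgebra ℤ (ℤ × ℤ)) ^ p =
        single (p • v i) (a i) + (p : AddMonoidAlgebra ℤ (ℤ × ℤ)) * single (p • v i) b := by
      rw [single_pow, show a i ^ p = a i + p * b by linarith, single_add]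
      congr 1
      rw [natCast_def, single_mul_single, zero_add]
    refine ⟨single (p • v i) b + g + single (v i) (a i) * (∑ i ∈ s, single (v i) (a i)) * r, ?_⟩
    rw [Finset.sum_insert hi, Finset.sum_insert hi, hr, hg, hs]
    ring

/-- A bounded configuration annihilated by `f` is annihilated by `f(X^p)` for large primes `p`. -/
theorem act_dilate_prime {ι : Type*} (s : Finset ι) (v : ι → ℤ × ℤ) (a : ι → ℤ) (B : ℤ)
    {p : ℕ} (hp : p.Prime) (hpB : (∑ i ∈ s, |a i|) * B < p) (y : Config ℤ)
    (hy : ∀ n, |y n| ≤ B) (h : act (∑ i ∈ s, single (v i) (a i)) y = 0) :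
    act (∑ i ∈ s, single (p • v i) (a i)) y = 0 := by
  obtain ⟨g, hg⟩ := exists_sum_single_pow s v a hp
  have h1 : act ((∑ i ∈ s, single (v i) (a i)) ^ p) y = 0 := by
    obtain ⟨k, rfl⟩ : ∃ k, p = k + 1 := ⟨p - 1, by have := hp.pos; omega⟩
    rw [pow_succ, act_mul, h, map_zero]
  rw [hg, map_add, LinearMap.add_apply, act_mul] at h1
  funext n
  have h2 := congrFun h1 n
  -- The value is a multiple of `p` because `f(X^p)` and `f^p` agree modulo `p`, but it is smaller
  -- than `p` in absolute value.
  have hz : act (∑ i ∈ s, single (p • v i) (a i)) y n = 0 := by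
    apply Int.eq_zero_of_abs_lt_dvd (m := p)
    · have h3 : act (p : AddMonoidAlgebra ℤ (ℤ × ℤ)) (act g y) n = p * act g y n := by
        rw [map_natCast]
        simp
      refine ⟨- act g y n, ?_⟩
      simp only [Pi.add_apply, Pi.zero_apply, h3] at h2
      linarith
    · rw [act_sum]
      calc |∑ i ∈ s, a i * y (n + p • v i)| ≤ ∑ i ∈ s, |a i * y (n + p • v i)| :=
            Finset.abs_sum_le_sum_abs _ _
        _ ≤ ∑ i ∈ s, |a i| * B := Finset.sum_le_sum fun i _ => by
            rw [abs_mul]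
            exact mul_le_mul_of_nonneg_left (hy _) (abs_nonneg _)
        _ < p := by rwa [← Finset.sum_mul]
  simpa using hz

/-- Dilation changes neither the coefficients nor the bound `B`, so the prime case can be iterated
over the prime factors of `k` with one and the same threshold. -/
theorem act_dilate {ι : Type*} (s : Finset ι) (v : ι → ℤ × ℤ) (a : ι → ℤ) (B : ℤ) (k : ℕ)
    (hk0 : k ≠ 0) (hk : ∀ p : ℕ, p.Prime → p ∣ k → (∑ i ∈ s, |a i|) * B < p) (y : Config ℤ)
    (hy : ∀ n, |y n| ≤ B) (h : act (∑ i ∈ s, single (v i) (a i)) y = 0) :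
    act (∑ i ∈ s, single (k • v i) (a i)) y = 0 := by
  induction k using Nat.recOnMul generalizing v with
  | zero => exact absurd rfl hk0
  | one => simpa using h
  | prime p hp => exact act_dilate_prime s v a B hp (hk p hp dvd_rfl) y hy h
  | mul k l ihk ihl =>
    have hl := ihl v (right_ne_zero_of_mul hk0) (fun p hp hd => hk p hp (hd.mul_left k)) h
    have := ihk (fun i => l • v i) (left_ne_zero_of_mul hk0)
      (fun p hp hd => hk p hp (hd.mul_right l)) hl
    simpa only [mul_smul] using this

theorem diffs_cons (w : ℤ × ℤ) (W : List (ℤ × ℤ)) (y : Config ℤ) :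
    diffs (w :: W) y = diff w (diffs W y) := rfl

theorem act_diff (w : ℤ × ℤ) (y : Config ℤ) : act (single w 1 - 1) y = diff w y := by
  funext n
  rw [map_sub, map_one, LinearMap.sub_apply, Pi.sub_apply, act_single]
  simp [diff]

theorem act_diffs (W : List (ℤ × ℤ)) (y : Config ℤ) :
    act (W.map fun w => (single w 1 - 1 : AddMonoidAlgebra ℤ (ℤ × ℤ))).prod y = diffs W y := by
  induction W with
  | nil => simp [diffs]
  | cons w W ih => rw [List.map_cons, List.prod_cons, act_mul, ih, act_diff, diffs_cons]

/-- Annihilation by all power sums extends linearly to any polynomial `Q`. Its coefficients may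
themselves be Laurent polynomials, which lets `Q` have monomials as prescribed roots. -/
theorem act_sum_mul_eval {ι : Type*} (s : Finset ι) (b z : ι → AddMonoidAlgebra ℤ (ℤ × ℤ))
    (y : Config ℤ) (h : ∀ i : ℕ, act (∑ v ∈ s, b v * z v ^ i) y = 0)
    (Q : Polynomial (AddMonoidAlgebra ℤ (ℤ × ℤ))) :
    act (∑ v ∈ s, b v * Q.eval (z v)) y = 0 := by
  induction Q using Polynomial.induction_on' with
  | add P Q hP hQ =>
    simp only [Polynomial.eval_add, mul_add, Finset.sum_add_distrib, map_add,
      LinearMap.add_apply, hP, hQ, add_zero]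
  | monomial i q =>
    have : ∑ v ∈ s, b v * (Polynomial.monomial i q).eval (z v) =
        q * ∑ v ∈ s, b v * z v ^ i := by
      rw [Finset.mul_sum]
      refine Finset.sum_congr rfl fun v _ => ?_
      rw [Polynomial.eval_monomial]
      ring
    rw [this, act_mul, h, map_zero]

/-- Bounded configurations annihilated by a given non-zero Laurent polynomial are annihilated by
a common product of difference operators. -/
theorem exists_diffs_eq_zero (s : Finset (ℤ × ℤ)) (a : ℤ × ℤ → ℤ) {v₀ : ℤ × ℤ} (hv₀ : v₀ ∈ s)
    (ha : a v₀ ≠ 0) (B : ℤ) :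
    ∃ W : List (ℤ × ℤ), (∀ w ∈ W, w ≠ 0) ∧ ∀ y : Config ℤ, (∀ n, |y n| ≤ B) →
      (∀ n, ∑ v ∈ s, a v * y (n + v) = 0) → diffs W y = 0 := by
  classical
  set M : ℕ := ((∑ v ∈ s, |a v|) * B).toNat with hM
  set r : ℕ := M.factorial with hr
  have hr0 : r ≠ 0 := Nat.factorial_ne_zero _
  refine ⟨(s.erase v₀).toList.map fun w => r • (w - v₀), ?_, fun y hy h => ?_⟩
  · intro w hw
    obtain ⟨u, hu, rfl⟩ := List.mem_map.1 hw
    rw [Finset.mem_toList, Finset.mem_erase] at hu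
    exact smul_ne_zero hr0 (sub_ne_zero.2 hu.1)
  have h0 : act (∑ v ∈ s, single v (a v)) y = 0 := by
    funext n
    rw [act_sum s (fun v => v) a]
    exact h n
  have hdil : ∀ i : ℕ, act (∑ v ∈ s, single v (a v) *
      (single (r • v) 1 : AddMonoidAlgebra ℤ (ℤ × ℤ)) ^ i) y = 0 := by
    intro i
    -- Every prime up to `M` divides `r = M!`, hence none divides `1 + i * r`: all these dilations
    -- are admissible.
    have := act_dilate s (fun v => v) a B (1 + i * r) (by omega) (fun p hp hd => by
      by_contra hlt
      have hpM : p ≤ M := by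
        have : (p : ℤ) ≤ (∑ v ∈ s, |a v|) * B := not_lt.1 hlt
        omega
      have h1 : p ∣ i * r := Dvd.dvd.mul_left (Nat.dvd_factorial hp.pos hpM) i
      exact hp.one_lt.ne' (Nat.dvd_one.1 ((Nat.dvd_add_left h1).1 hd))) y hy h0
    rw [← this]
    congr 2
    refine Finset.sum_congr rfl fun v _ => ?_
    rw [single_pow, single_mul_single, one_pow, mul_one, add_smul, one_smul, mul_smul]
  -- This polynomial has the roots `X^(r w)` for `w ≠ v₀`, so only the term of `v₀` survives.
  have hQ := act_sum_mul_eval s _ _ y hdil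
    (∏ w ∈ s.erase v₀, (Polynomial.X - Polynomial.C (single (r • w) 1)))
  set P : AddMonoidAlgebra ℤ (ℤ × ℤ) :=
    ∏ w ∈ s.erase v₀, (single (r • (w - v₀)) 1 - 1) with hP
  rw [Finset.sum_eq_single v₀] at hQ
  rotate_left
  · intro v hv hne
    rw [Polynomial.eval_prod, Finset.prod_eq_zero (Finset.mem_erase.2 ⟨hne, hv⟩), mul_zero]
    simp
  · exact fun hn => absurd hv₀ hn
  have hev : Polynomial.eval (single (r • v₀) 1 : AddMonoidAlgebra ℤ (ℤ × ℤ))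
      (∏ w ∈ s.erase v₀, (Polynomial.X - Polynomial.C (single (r • w) 1))) =
      (-single (r • v₀) 1) ^ (s.erase v₀).card * P := by
    rw [Polynomial.eval_prod, hP, ← Finset.prod_const, ← Finset.prod_mul_distrib]
    refine Finset.prod_congr rfl fun w _ => ?_
    rw [Polynomial.eval_sub, Polynomial.eval_X, Polynomial.eval_C, mul_sub, neg_mul,
      single_mul_single, ← smul_add, add_sub_cancel, mul_one, mul_one]
    ring
  rw [hev] at hQ
  -- Monomials are units; removing them leaves the integer `a v₀` times `P`, and `a v₀` cancels
  -- pointwise.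
  have hinv : (single (-v₀) 1 * (-single (-(r • v₀)) 1) ^ (s.erase v₀).card) *
      (single v₀ (a v₀) * ((-single (r • v₀) 1) ^ (s.erase v₀).card * P)) =
      single 0 (a v₀) * P := by
    have e1 : (-single (-(r • v₀)) 1) ^ (s.erase v₀).card *
        (-single (r • v₀) 1 : AddMonoidAlgebra ℤ (ℤ × ℤ)) ^ (s.erase v₀).card = 1 := by
      rw [← mul_pow, neg_mul_neg, single_mul_single, neg_add_cancel, mul_one, ← one_def, one_pow]
    have e2 : single (-v₀) 1 * single v₀ (a v₀) =
        (single 0 (a v₀) : AddMonoidAlgebra ℤ (ℤ × ℤ)) := by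
      rw [single_mul_single, neg_add_cancel, one_mul]
    rw [← e2]
    linear_combination (single (-v₀) 1 * single v₀ (a v₀) * P) * e1
  have hfin := congrArg (act (single (-v₀) 1 * (-single (-(r • v₀)) 1) ^ (s.erase v₀).card)) hQ
  rw [← act_mul, hinv, map_zero, act_mul] at hfin
  have hPy : act P y = 0 := by
    funext n
    have := congrFun hfin n
    rw [act_single, add_zero, Pi.zero_apply] at this
    exact (mul_eq_zero.1 this).resolve_left ha
  rw [← act_diffs, List.map_map, ← hPy, hP, ← Finset.prod_map_toList]
  rfl


/-! ### Difference operators on bounded configurations and on half-planes -/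

theorem diff_comm (v w : ℤ × ℤ) (y : Config ℤ) : diff v (diff w y) = diff w (diff v y) := by
  funext n
  simp only [diff, add_right_comm n v w]
  ring

theorem diffs_diff (W : List (ℤ × ℤ)) (w : ℤ × ℤ) (y : Config ℤ) :
    diffs W (diff w y) = diff w (diffs W y) := by
  induction W with
  | nil => rfl
  | cons v W ih => rw [diffs_cons, diffs_cons, ih, diff_comm]

theorem diff_zero (w : ℤ × ℤ) : diff w 0 = 0 := by
  funext n
  simp [diff]

theorem diffs_sub (W : List (ℤ × ℤ)) (y z : Config ℤ) :
    diffs W (y - z) = diffs W y - diffs W z := by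
  induction W with
  | nil => rfl
  | cons v W ih =>
    rw [diffs_cons, diffs_cons, diffs_cons, ih]
    funext n
    simp only [diff, Pi.sub_apply]
    ring

theorem add_nsmul_of_diff_eq_zero {w : ℤ × ℤ} {y : Config ℤ} (h : diff w y = 0) (k : ℕ)
    (n : ℤ × ℤ) : y (n + k • w) = y n := by
  induction k with
  | zero => simp
  | succ k ih =>
    have := congrFun h (n + k • w)
    simp only [diff, Pi.zero_apply] at this
    rw [succ_nsmul, ← add_assoc, ← ih]
    linarith

theorem sub_nsmul_of_diff_eq_zero {w : ℤ × ℤ} {y : Config ℤ} (h : diff w y = 0) (k : ℕ)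
    (n : ℤ × ℤ) : y (n - k • w) = y n := by
  rw [← add_nsmul_of_diff_eq_zero h k (n - k • w), sub_add_cancel]

/-- A bounded configuration whose second difference vanishes has vanishing difference. -/
theorem diff_eq_zero_of_diff_diff {w : ℤ × ℤ} {y : Config ℤ} {B : ℕ} (hy : ∀ n, |y n| ≤ B)
    (h : diff w (diff w y) = 0) : diff w y = 0 := by
  funext n
  have key : ∀ k : ℕ, y (n + k • w) = y n + k * diff w y n := by
    intro k
    induction k with
    | zero => simp
    | succ k ih =>
      have h1 := add_nsmul_of_diff_eq_zero h k n
      have h2 : diff w y (n + k • w) = y (n + (k + 1) • w) - y (n + k • w) := by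
        rw [succ_nsmul, ← add_assoc]
        rfl
      push_cast
      linarith
  -- A non-zero slope would move `y` by at least `2 * B + 1`, more than the range from `-B` to `B`
  -- allows.
  have h1 := key (2 * B + 1)
  have h2 := abs_le.1 (hy n)
  have h3 := abs_le.1 (hy (n + (2 * B + 1) • w))
  rw [h1] at h3
  push_cast at h3
  by_contra hne
  rcases lt_or_gt_of_ne (show diff w y n ≠ 0 from hne) with hlt | hgt
  · nlinarith
  · nlinarith

/-- A product of difference operators along the horizontal axis forces a common period on bounded
configurations. -/
theorem exists_horizontal_period (W : List (ℤ × ℤ)) (hW : ∀ w ∈ W, w ≠ 0 ∧ w.2 = 0) :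
    ∃ p : ℕ, 0 < p ∧ ∀ (z : Config ℤ) (B : ℕ), (∀ n, |z n| ≤ B) → diffs W z = 0 →
      diff ((p : ℤ), 0) z = 0 := by
  induction W with
  | nil =>
    refine ⟨1, one_pos, fun z B _ h => ?_⟩
    rw [show z = 0 from h, diff_zero]
  | cons w W ih =>
    obtain ⟨p, hp, H⟩ := ih fun v hv => hW v (List.mem_cons_of_mem _ hv)
    obtain ⟨hw0, hw2⟩ := hW w List.mem_cons_self
    have hw1 : w.1 ≠ 0 := fun h => hw0 (Prod.ext h hw2)
    refine ⟨p * w.1.natAbs, Nat.mul_pos hp (Int.natAbs_pos.2 hw1), fun z B hz h => ?_⟩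
    rw [diffs_cons, ← diffs_diff] at h
    have h1 : diff ((p : ℤ), 0) (diff w z) = 0 := by
      refine H _ (2 * B) (fun n => ?_) h
      have h2 := abs_le.1 (hz n)
      have h3 := abs_le.1 (hz (n + w))
      rw [abs_le]
      simp only [diff]
      push_cast
      constructor <;> linarith
    -- `q` is a common multiple, up to sign, of `(p, 0)` and `w`. The first makes `diff q z`
    -- invariant under `w`, the second then makes it invariant under `q`.
    set q : ℤ × ℤ := (((p * w.1.natAbs : ℕ) : ℤ), 0) with hq
    have hqp : q = w.1.natAbs • (((p : ℤ), 0) : ℤ × ℤ) := by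
      ext <;> simp [hq, mul_comm]
    have h2 : diff w (diff q z) = 0 := by
      rw [diff_comm]
      funext n
      have := add_nsmul_of_diff_eq_zero h1 w.1.natAbs n
      rw [← hqp] at this
      simp only [diff] at this ⊢
      simp only [Pi.zero_apply]
      linarith
    have h3 : diff q (diff q z) = 0 := by
      funext n
      change diff q z (n + q) - diff q z n = 0
      rcases Int.natAbs_eq w.1 with hs | hs
      · have : q = p • w := by
          ext
          · rw [Prod.smul_fst, nsmul_eq_mul, hq, Nat.cast_mul, ← hs]
          · simp [hq, hw2]
        have h4 := add_nsmul_of_diff_eq_zero h2 p n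
        rw [← this] at h4
        rw [h4, sub_self]
      · have : q = - (p • w) := by
          ext
          · rw [Prod.fst_neg, Prod.smul_fst, nsmul_eq_mul, hq, Nat.cast_mul]
            conv_rhs => rw [hs]
            ring
          · simp [hq, hw2]
        have h4 := sub_nsmul_of_diff_eq_zero h2 p n
        rw [sub_eq_add_neg, ← this] at h4
        rw [h4, sub_self]
    exact diff_eq_zero_of_diff_diff hz h3

/-- Every orbit of translation by `w` enters the half-plane where `y` vanishes, forwards or
backwards according to the sign of `L w`, and `y` is constant along it. -/
theorem eq_zero_of_diff_eq_zero (L : ℤ × ℤ →+ ℝ) {w : ℤ × ℤ} (hw : L w ≠ 0) {y : Config ℤ} {c : ℝ}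
    (hy : ∀ n, L n < c → y n = 0) (h : diff w y = 0) : y = 0 := by
  funext n
  rcases lt_or_gt_of_ne hw with hlt | hgt
  · obtain ⟨k, hk⟩ := exists_nat_gt ((L n - c) / (- L w))
    rw [div_lt_iff₀ (by linarith)] at hk
    rw [← add_nsmul_of_diff_eq_zero h k n]
    apply hy
    rw [map_add, map_nsmul, nsmul_eq_mul]
    linarith
  · obtain ⟨k, hk⟩ := exists_nat_gt ((L n - c) / L w)
    rw [div_lt_iff₀ hgt] at hk
    rw [← sub_nsmul_of_diff_eq_zero h k n]
    apply hy
    rw [map_sub, map_nsmul, nsmul_eq_mul]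
    linarith

theorem diff_eq_zero_on_halfPlane (L : ℤ × ℤ →+ ℝ) (w : ℤ × ℤ) {z : Config ℤ} {c : ℝ}
    (hz : ∀ n, L n < c → z n = 0) : ∃ c' : ℝ, ∀ n, L n < c' → diff w z n = 0 := by
  refine ⟨min c (c - L w), fun n hn => ?_⟩
  have h1 := lt_of_lt_of_le hn (min_le_left _ _)
  have h2 := lt_of_lt_of_le hn (min_le_right _ _)
  simp only [diff]
  rw [hz n h1, hz (n + w) (by rw [map_add]; linarith), sub_self]

theorem diffs_eq_zero_on_halfPlane (L : ℤ × ℤ →+ ℝ) (W : List (ℤ × ℤ)) {z : Config ℤ} {c : ℝ}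
    (hz : ∀ n, L n < c → z n = 0) : ∃ c' : ℝ, ∀ n, L n < c' → diffs W z n = 0 := by
  induction W with
  | nil => exact ⟨c, hz⟩
  | cons w W ih =>
    obtain ⟨c', hc'⟩ := ih
    exact diff_eq_zero_on_halfPlane L w hc'

/-- For a configuration that vanishes on a half-plane, the difference operators transversal to
its boundary can be cancelled. -/
theorem diffs_filter_eq_zero (L : ℤ × ℤ →+ ℝ) [DecidablePred fun w => L w = 0]
    (W : List (ℤ × ℤ)) (z : Config ℤ) (c : ℝ) (hz : ∀ n, L n < c → z n = 0)
    (h : diffs W z = 0) : diffs (W.filter fun w => L w = 0) z = 0 := by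
  induction W generalizing z c with
  | nil => exact h
  | cons w W ih =>
    by_cases hw : L w = 0
    · rw [List.filter_cons_of_pos (by simpa using hw), diffs_cons, ← diffs_diff]
      obtain ⟨c', hc'⟩ := diff_eq_zero_on_halfPlane L w hz
      exact ih _ c' hc' (by rw [diffs_diff]; exact h)
    · rw [List.filter_cons_of_neg (by simpa using hw)]
      obtain ⟨c', hc'⟩ := diffs_eq_zero_on_halfPlane L W hz
      exact ih z c hz (eq_zero_of_diff_eq_zero L hw hc' h)

/-! ### Affine relations from low complexity -/

/-- The set of `S`-patterns of a set of configurations. -/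
def patternSet {A : Type*} (X : Set (Config A)) (S : Finset (ℤ × ℤ)) : Set (S → A) :=
  (fun x (s : S) => x s) '' X

/-- A set of configurations with at most `|S|` patterns of shape `S` satisfies a non-trivial
affine relation on `S`. -/
theorem exists_relation {A : Type*} [Finite A] (e : A → ℤ) (X : Set (Config A))
    (hX : X.Nonempty)
    (S : Finset (ℤ × ℤ)) (h : (patternSet X S).ncard ≤ S.card) :
    ∃ (a : ℤ × ℤ → ℤ) (κ : ℤ), (∃ v ∈ S, a v ≠ 0) ∧ ∀ x ∈ X, ∑ v ∈ S, a v * e (x v) = κ := by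
  classical
  have : Fintype (patternSet X S) := Fintype.ofFinite _
  -- The unknowns are the coefficients and the constant, `|S| + 1` in all; there is one equation per
  -- pattern, hence at most `|S|` equations.
  let F : ((S → ℤ) × ℤ) →ₗ[ℤ] (patternSet X S → ℤ) :=
    { toFun := fun a q => (∑ v : S, a.1 v * e (q.1 v)) - a.2
      map_add' := by
        intro a b
        funext q
        simp only [Prod.fst_add, Prod.snd_add, Pi.add_apply, add_mul, Finset.sum_add_distrib]
        ring
      map_smul' := by
        intro r a
        funext q
        simp only [Prod.smul_fst, Prod.smul_snd, Pi.smul_apply, smul_eq_mul, RingHom.id_apply,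
          mul_assoc, mul_sub, Finset.mul_sum] }
  have hni : ¬ Function.Injective F := by
    intro hinj
    have := LinearMap.finrank_le_finrank_of_injective hinj
    rw [Module.finrank_prod, Module.finrank_fintype_fun_eq_card, Module.finrank_self,
      Module.finrank_fintype_fun_eq_card, Fintype.card_coe, ← Nat.card_eq_fintype_card,
      Nat.card_coe_set_eq] at this
    omega
  rw [← LinearMap.ker_eq_bot, Submodule.eq_bot_iff] at hni
  push Not at hni
  obtain ⟨⟨a, κ⟩, hker, hne⟩ := hni
  have hF : ∀ x ∈ X, ∑ v : S, a v * e (x v) = κ := fun x hx =>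
    sub_eq_zero.1 (congrFun (LinearMap.mem_ker.1 hker) ⟨fun s : S => x s, x, hx, rfl⟩)
  refine ⟨fun v => if hv : v ∈ S then a ⟨v, hv⟩ else 0, κ, ?_, fun x hx => ?_⟩
  -- With all coefficients zero, any element of `X` forces `κ = 0`, against the choice of a non-zero
  -- kernel vector.
  · by_contra! hzero
    have ha : a = 0 := by
      funext v
      have := hzero v v.2
      rwa [dif_pos v.2] at this
    obtain ⟨x, hx⟩ := hX
    have := hF x hx
    apply hne
    rw [ha] at this ⊢
    rw [← this]
    simp
  · rw [← hF x hx, ← Finset.sum_coe_sort S]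
    exact Finset.sum_congr rfl fun v _ => by simp only [dif_pos v.2]

/-! ### Bounded solutions of one-dimensional linear recurrences -/

section Recurrence

variable {s : Finset ℤ} {a : ℤ → ℤ} {lo hi : ℤ}

/-- A solution of a homogeneous linear recurrence vanishing on a window vanishes. -/
theorem eq_zero_of_recurrence (hs : ∀ i ∈ s, lo ≤ i ∧ i ≤ hi) (hlo : lo ∈ s) (hhi : hi ∈ s)
    (alo : a lo ≠ 0) (ahi : a hi ≠ 0) {u : ℤ → ℤ} (hu : ∀ t, ∑ i ∈ s, a i * u (t + i) = 0)
    {m : ℤ} (h0 : ∀ j, m ≤ j → j < m + (hi - lo) → u j = 0) (t : ℤ) : u t = 0 := by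
  have hle := (hs lo hlo).2
  have up : ∀ k : ℕ, ∀ j, m ≤ j → j < m + (hi - lo) + k → u j = 0 := by
    intro k
    induction k with
    | zero => simpa using h0
    | succ k ih =>
      intro j hj1 hj2
      by_cases hj : j < m + (hi - lo) + k
      · exact ih j hj1 hj
      · have := hu (j - hi)
        rw [Finset.sum_eq_single hi] at this
        · rw [sub_add_cancel] at this
          exact (mul_eq_zero.1 this).resolve_left ahi
        · intro i his hne
          have := hs i his
          rw [ih _ (by push_cast at hj2; omega) (by push_cast at hj2; omega), mul_zero]
        · exact fun hn => absurd hhi hn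
  have down : ∀ k : ℕ, ∀ j, m - k ≤ j → j < m + (hi - lo) → u j = 0 := by
    intro k
    induction k with
    | zero => simpa using h0
    | succ k ih =>
      intro j hj1 hj2
      by_cases hj : m - k ≤ j
      · exact ih j hj hj2
      · have := hu (j - lo)
        rw [Finset.sum_eq_single lo] at this
        · rw [sub_add_cancel] at this
          exact (mul_eq_zero.1 this).resolve_left alo
        · intro i his hne
          have := hs i his
          rw [ih _ (by push_cast at hj1; omega) (by push_cast at hj1; omega), mul_zero]
        · exact fun hn => absurd hlo hn
  rcases le_or_gt m t with h | h
  · exact up (t - m + 1).toNat t h (by omega)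
  · rcases eq_or_lt_of_le hle with he | hlt
    · have := hu (t - lo)
      rw [Finset.sum_eq_single lo] at this
      · rw [sub_add_cancel] at this
        exact (mul_eq_zero.1 this).resolve_left alo
      · intro i his hne
        have := hs i his
        omega
      · exact fun hn => absurd hlo hn
    · exact down (m - t).toNat t (by omega) (by omega)

/-- Bounded integer sequences satisfying a given non-trivial linear recurrence with constant
right-hand side have a common period. -/
theorem exists_recurrence_period (s : Finset ℤ) (a : ℤ → ℤ) (ha : ∃ i ∈ s, a i ≠ 0) (B : ℕ) :
    ∃ Q : ℕ, 0 < Q ∧ ∀ (y : ℤ → ℤ) (κ : ℤ), (∀ t, |y t| ≤ B) →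
      (∀ t, ∑ i ∈ s, a i * y (t + i) = κ) → ∀ t, y (t + Q) = y t := by
  classical
  -- Dropping zero coefficients makes both extreme coefficients non-zero, so the recurrence
  -- determines a sequence in both directions.
  set s' := s.filter fun i => a i ≠ 0 with hs'
  have hne : s'.Nonempty := by
    obtain ⟨i, hi, hai⟩ := ha
    exact ⟨i, Finset.mem_filter.2 ⟨hi, hai⟩⟩
  set lo := s'.min' hne with hlo
  set hi := s'.max' hne with hhi
  have hlo' : lo ∈ s' := Finset.min'_mem _ _
  have hhi' : hi ∈ s' := Finset.max'_mem _ _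
  set d : ℕ := (hi - lo).toNat with hd
  have hle : lo ≤ hi := Finset.min'_le _ _ hhi'
  -- A window of `d` consecutive values determines the solution. Two of the first `|V| + 1` windows
  -- coincide, so some period is at most `|V|`, and `|V|!` serves all solutions at once.
  set V := Fin d → Finset.Icc (-(B : ℤ)) B with hV
  refine ⟨(Fintype.card V).factorial, Nat.factorial_pos _, fun y κ hy hrec => ?_⟩
  let win : Fin (Fintype.card V + 1) → V := fun k i =>
    ⟨y (k.1 + i.1), Finset.mem_Icc.2 (abs_le.1 (hy _))⟩
  obtain ⟨k, l, hkl, hwin⟩ := Fintype.exists_ne_map_eq_of_card_lt win (by simp)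
  wlog hlt : k.1 < l.1 generalizing k l
  · exact this l k hkl.symm hwin.symm (by
      have : k.1 ≠ l.1 := fun h => hkl (Fin.ext h)
      omega)
  have hper : ∀ t, y (t + (l.1 - k.1 : ℕ)) = y t := by
    intro t
    have hsum : ∀ t, ∑ i ∈ s', a i * y (t + i) = κ := fun t => by
      rw [← hrec t, hs', Finset.sum_filter]
      refine Finset.sum_congr rfl fun i _ => ?_
      split_ifs with h
      · rfl
      · rw [not_not.1 h, zero_mul]
    -- The constant `κ` cancels in the difference of the sequence and its shift.
    have := eq_zero_of_recurrence (s := s') (a := a) (lo := lo) (hi := hi)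
      (fun i hi => ⟨Finset.min'_le _ _ hi, Finset.le_max' _ _ hi⟩) hlo' hhi'
      (Finset.mem_filter.1 hlo').2 (Finset.mem_filter.1 hhi').2
      (u := fun t => y (t + (l.1 - k.1 : ℕ)) - y t) (fun t => by
        have h1 := hsum (t + (l.1 - k.1 : ℕ))
        have h2 := hsum t
        rw [← sub_eq_zero, ← h2] at h1
        rw [← h1, ← Finset.sum_sub_distrib]
        refine Finset.sum_congr rfl fun i _ => ?_
        rw [mul_sub, add_right_comm]) (m := k.1) (fun j hj1 hj2 => by
        have := congrArg Subtype.val (congrFun hwin ⟨(j - k.1).toNat, by omega⟩)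
        simp only [win] at this
        rw [sub_eq_zero]
        convert this.symm using 2 <;> omega) t
    linarith
  have hmul : ∀ (m : ℕ) t, y (t + m * (l.1 - k.1 : ℕ)) = y t := by
    intro m
    induction m with
    | zero => simp
    | succ m ih =>
      intro t
      rw [← ih t, ← hper (t + m * (l.1 - k.1 : ℕ))]
      congr 1
      push_cast
      ring
  obtain ⟨m, hm⟩ : (l.1 - k.1) ∣ (Fintype.card V).factorial :=
    Nat.dvd_factorial (by omega) (by omega)
  intro t
  rw [hm, mul_comm (l.1 - k.1) m, Nat.cast_mul]
  exact hmul m t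

end Recurrence


/-! ### Minimal subshifts and asymptotic pairs -/

open Filter Topology

/-- The shift of a configuration by `t`. -/
def shift {A : Type*} (t : ℤ × ℤ) (x : Config A) : Config A := fun n => x (n + t)

/-- A minimal subshift: a non-empty closed shift-invariant set in which every finite pattern of
every element occurs in every element. -/
structure IsMinimalSubshift {A : Type*} [TopologicalSpace A] (X : Set (Config A)) : Prop where
  nonempty : X.Nonempty
  isClosed : IsClosed X
  shift_mem : ∀ t, ∀ x ∈ X, shift t x ∈ X
  recurrent : ∀ x ∈ X, ∀ y ∈ X, ∀ F : Finset (ℤ × ℤ), ∃ t, ∀ n ∈ F, x (n + t) = y n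

theorem shift_shift {A : Type*} (s t : ℤ × ℤ) (x : Config A) :
    shift s (shift t x) = shift (s + t) x := by
  funext n
  simp [shift, add_assoc]

theorem shift_zero {A : Type*} (x : Config A) : shift 0 x = x := by
  funext n
  simp [shift]

theorem isPeriodic_of_shift_eq {A : Type*} {x : Config A} {t : ℤ × ℤ} (ht : t ≠ 0)
    (h : shift t x = x) : IsPeriodic x := by
  refine ⟨-t, neg_ne_zero.2 ht, ?_⟩
  funext n
  have := congrFun h n
  simpa [translate, shift, sub_neg_eq_add] using this

theorem IsPeriodic.exists_shift_eq {A : Type*} {x : Config A} (h : IsPeriodic x) :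
    ∃ t ≠ 0, shift t x = x := by
  obtain ⟨t, ht, h⟩ := h
  refine ⟨-t, neg_ne_zero.2 ht, ?_⟩
  funext n
  have := congrFun h n
  simpa [translate, shift, ← sub_eq_add_neg] using this

section Topological

variable {A : Type*}

theorem continuous_shift [TopologicalSpace A] (t : ℤ × ℤ) : Continuous (shift t : Config A → Config A) :=
  continuous_pi fun _ => continuous_apply _

/-- Every sequence of configurations over a finite alphabet converges along an ultrafilter. -/
theorem exists_ultralimit [Finite A] (U : Ultrafilter ℕ) (z : ℕ → Config A) :
    ∃ x : Config A, ∀ n, ∀ᶠ k in U, z k n = x n := by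
  have : ∀ n, ∃ a, ∀ᶠ k in U, z k n = a := by
    intro n
    have h : ∀ᶠ k in (U : Filter ℕ), ∃ a ∈ (Set.univ : Set A), z k n = a :=
      Eventually.of_forall fun k => ⟨z k n, trivial, rfl⟩
    obtain ⟨a, -, ha⟩ := (Ultrafilter.eventually_exists_mem_iff (Set.toFinite _)).1 h
    exact ⟨a, ha⟩
  choose x hx using this
  exact ⟨x, hx⟩

variable [TopologicalSpace A]

theorem mem_of_ultralimit [DiscreteTopology A] {X : Set (Config A)} (hX : IsClosed X)
    {U : Ultrafilter ℕ} {z : ℕ → Config A} (hz : ∀ k, z k ∈ X) {x : Config A}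
    (h : ∀ n, ∀ᶠ k in U, z k n = x n) : x ∈ X := by
  refine hX.mem_of_tendsto (f := z) (b := (U : Filter ℕ)) ?_ (Eventually.of_forall hz)
  rw [tendsto_pi_nhds]
  intro n
  rw [nhds_discrete, tendsto_pure]
  exact h n

/-- Zorn's lemma, with compactness for intersections of chains. In a minimal invariant closed set
every orbit closure is the whole set, which is the recurrence property. -/
theorem exists_minimalSubshift [Finite A] [DiscreteTopology A] (Y : Set (Config A))
    (hY : Y.Nonempty)
    (hc : IsClosed Y) (hs : ∀ t, ∀ x ∈ Y, shift t x ∈ Y) : ∃ X ⊆ Y, IsMinimalSubshift X := by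
  obtain ⟨X, hXY, hX⟩ := zorn_superset_nonempty
    {X : Set (Config A) | X.Nonempty ∧ IsClosed X ∧ ∀ t, ∀ x ∈ X, shift t x ∈ X} (by
      intro C hC hchain hne
      refine ⟨⋂₀ C, ⟨?_, isClosed_sInter fun s hs => (hC hs).2.1, fun t x hx s hs =>
        (hC hs).2.2 t x (hx s hs)⟩, fun s hs => Set.sInter_subset_of_mem hs⟩
      have := hne.to_subtype
      exact IsCompact.nonempty_sInter_of_directed_nonempty_isCompact_isClosed
        (fun s hs t ht => (hchain.total hs ht).elim (fun h => ⟨s, hs, subset_rfl, h⟩)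
          fun h => ⟨t, ht, h, subset_rfl⟩) (fun s hs => (hC hs).1) (fun s hs => (hC hs).2.1.isCompact)
        (fun s hs => (hC hs).2.1))
    Y ⟨hY, hc, hs⟩
  refine ⟨X, hXY, hX.prop.1, hX.prop.2.1, hX.prop.2.2, fun x hx y hy F => ?_⟩
  have hsub : closure {z | ∃ t, z = shift t x} ⊆ X := by
    refine closure_minimal ?_ hX.prop.2.1
    rintro _ ⟨t, rfl⟩
    exact hX.prop.2.2 t x hx
  have hmem : y ∈ closure {z | ∃ t, z = shift t x} := by
    refine hX.le_of_le (y := closure {z | ∃ t, z = shift t x}) ⟨⟨x, subset_closure ⟨0, (shift_zero x).symm⟩⟩, isClosed_closure, ?_⟩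
      hsub hy
    intro t z hz
    have := image_closure_subset_closure_image (continuous_shift (A := A) t) ⟨z, hz, rfl⟩
    refine closure_mono ?_ this
    rintro _ ⟨_, ⟨s, rfl⟩, rfl⟩
    exact ⟨t + s, shift_shift t s x⟩
  have hopen : {z : Config A | ∀ n ∈ F, z n = y n} ∈ 𝓝 y := by
    have : {z : Config A | ∀ n ∈ F, z n = y n} = ⋂ n ∈ F, (fun z : Config A => z n) ⁻¹' {y n} := by
      ext z
      simp
    rw [this, biInter_finset_mem]
    intro n _
    exact (continuous_apply n).continuousAt.preimage_mem_nhds (by simp [nhds_discrete])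
  obtain ⟨z, hz, t, rfl⟩ := mem_closure_iff_nhds.1 hmem _ hopen
  exact ⟨t, hz⟩

theorem exists_isPeriodic_of_finite {X : Set (Config A)} (hX : IsMinimalSubshift X)
    (hf : X.Finite) : ∃ x ∈ X, IsPeriodic x := by
  obtain ⟨x, hx⟩ := hX.nonempty
  obtain ⟨k, -, l, -, hkl, h⟩ := Set.infinite_univ.exists_ne_map_eq_of_mapsTo
    (f := fun k : ℤ => shift (k, 0) x) (fun k _ => hX.shift_mem _ x hx) hf
  refine ⟨x, hx, isPeriodic_of_shift_eq (t := (l - k, 0)) ?_ ?_⟩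
  · simpa [Prod.ext_iff, sub_eq_zero] using hkl.symm
  · have := congrArg (shift (-k, 0)) h
    simp only [shift_shift, Prod.mk_add_mk, neg_add_cancel, add_zero] at this
    rw [show ((0 : ℤ), (0 : ℤ)) = 0 from rfl, shift_zero] at this
    rw [sub_eq_neg_add, this.symm]

/-- An infinite subshift contains two distinct elements that agree on an open half-plane. -/
theorem exists_asymptotic_pair [Finite A] [DiscreteTopology A] {X : Set (Config A)}
    (hX : IsMinimalSubshift X) (hinf : X.Infinite) :
    ∃ L : ℤ × ℤ →+ ℝ, L ≠ 0 ∧ ∃ x ∈ X, ∃ y ∈ X, x ≠ y ∧ ∀ n, L n < 0 → x n = y n := by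
  classical
  let N : ℤ × ℤ → ℕ := fun n => (n.1 ^ 2 + n.2 ^ 2).toNat
  have hN : ∀ n, (N n : ℤ) = n.1 ^ 2 + n.2 ^ 2 := fun n => Int.toNat_of_nonneg (by positivity)
  -- By pigeonhole two elements agree on a large square; `q` is a disagreement nearest to the
  -- origin, so they agree on the open disc through `q`.
  have hstep : ∀ k : ℕ, ∃ x ∈ X, ∃ y ∈ X, ∃ q : ℤ × ℤ, k * k ≤ N q ∧ x q ≠ y q ∧
      ∀ n, N n < N q → x n = y n := by
    intro k
    obtain ⟨x, hx, y, hy, hxy, h⟩ := hinf.exists_ne_map_eq_of_mapsTo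
      (f := fun x (n : (Finset.Icc (-(k : ℤ)) k ×ˢ Finset.Icc (-(k : ℤ)) k : Finset (ℤ × ℤ))) =>
        x n) (t := Set.univ) (fun _ _ => trivial) (Set.toFinite _)
    have hex : ∃ m, ∃ q, N q = m ∧ x q ≠ y q := by
      obtain ⟨q, hq⟩ := Function.ne_iff.1 hxy
      exact ⟨N q, q, rfl, hq⟩
    obtain ⟨q, hq, hne⟩ := Nat.find_spec hex
    refine ⟨x, hx, y, hy, q, ?_, hne, fun n hn => ?_⟩
    · by_contra! hlt
      apply hne
      have hlt' : q.1 ^ 2 + q.2 ^ 2 < (k : ℤ) * k := by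
        rw [← hN]
        exact_mod_cast hlt
      refine congrFun h ⟨q, ?_⟩
      rw [Finset.mem_product, Finset.mem_Icc, Finset.mem_Icc, ← abs_le, ← abs_le]
      exact ⟨abs_le_of_sq_le_sq (by nlinarith [sq_nonneg q.2]) (by positivity),
        abs_le_of_sq_le_sq (by nlinarith [sq_nonneg q.1]) (by positivity)⟩
    · by_contra hcon
      exact Nat.find_min hex (by rwa [hq] at hn) ⟨n, rfl, hcon⟩
  choose x hx y hy q hkq hne heq using hstep
  let R : ℕ → ℝ := fun k => √(N (q k))
  have hNR : ∀ n, (N n : ℝ) = (n.1 : ℝ) ^ 2 + (n.2 : ℝ) ^ 2 := fun n => by exact_mod_cast hN n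
  have hR2 : ∀ k, R k ^ 2 = ((q k).1 : ℝ) ^ 2 + ((q k).2 : ℝ) ^ 2 := fun k => by
    rw [← hNR]
    exact Real.sq_sqrt (by positivity)
  have hRk : ∀ k : ℕ, (k : ℝ) ≤ R k := fun k => by
    refine Real.le_sqrt_of_sq_le ?_
    rw [sq]
    exact_mod_cast hkq k
  have hR0 : ∀ k, 0 ≤ R k := fun k => Real.sqrt_nonneg _
  have hRpos : ∀ᶠ k in atTop, 0 < R k := by
    filter_upwards [eventually_gt_atTop 0] with k hk
    exact lt_of_lt_of_le (by exact_mod_cast hk) (hRk k)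
  let U : Ultrafilter ℕ := hyperfilter ℕ
  have hU : (U : Filter ℕ) ≤ atTop := by
    rw [← Nat.cofinite_eq_atTop]
    exact hyperfilter_le_cofinite
  have hcoord : ∀ f : ℕ → ℤ, (∀ k, (f k : ℝ) ^ 2 ≤ R k ^ 2) →
      ∃ α : ℝ, Tendsto (fun k => f k / R k) U (𝓝 α) := by
    intro f hf
    obtain ⟨α, -, hα⟩ := (isCompact_Icc (a := (-1 : ℝ)) (b := 1)).ultrafilter_le_nhds
      (U.map fun k => f k / R k) (by
        rw [le_principal_iff, Ultrafilter.mem_coe, Ultrafilter.mem_map]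
        refine univ_mem' fun k => ?_
        rw [Set.mem_preimage, Set.mem_Icc, ← abs_le, abs_div, abs_of_nonneg (hR0 k)]
        exact div_le_one_of_le₀ (abs_le_of_sq_le_sq (hf k) (hR0 k)) (hR0 k))
    exact ⟨α, hα⟩
  obtain ⟨α, hα⟩ := hcoord (fun k => (q k).1) fun k => by
    rw [hR2]; nlinarith [sq_nonneg ((q k).2 : ℝ)]
  obtain ⟨β, hβ⟩ := hcoord (fun k => (q k).2) fun k => by
    rw [hR2]; nlinarith [sq_nonneg ((q k).1 : ℝ)]
  have hαβ : α ^ 2 + β ^ 2 = 1 := by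
    refine tendsto_nhds_unique ((hα.pow 2).add (hβ.pow 2)) ?_
    refine tendsto_const_nhds.congr' ?_
    filter_upwards [hU hRpos] with k hk
    rw [div_pow, div_pow, ← add_div, ← hR2, div_self (by positivity)]
  -- The inner product with the limit direction of `q k`. Recentred at `q k`, the growing discs fill
  -- the open half-plane `L < 0`.
  let L : ℤ × ℤ →+ ℝ :=
    { toFun := fun n => n.1 * α + n.2 * β
      map_zero' := by simp
      map_add' := fun m n => by
        simp only [Prod.fst_add, Prod.snd_add]
        push_cast
        ring }
  have hLdef : ∀ n, L n = n.1 * α + n.2 * β := fun n => rfl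
  refine ⟨L, fun h0 => ?_, ?_⟩
  · have h1 : L (1, 0) = 0 := by rw [h0]; rfl
    have h2 : L (0, 1) = 0 := by rw [h0]; rfl
    simp [hLdef] at h1 h2
    rw [h1, h2] at hαβ
    norm_num at hαβ
  obtain ⟨x', hx'⟩ := exists_ultralimit U fun k => shift (q k) (x k)
  obtain ⟨y', hy'⟩ := exists_ultralimit U fun k => shift (q k) (y k)
  refine ⟨x', mem_of_ultralimit hX.isClosed (fun k => hX.shift_mem _ _ (hx k)) hx',
    y', mem_of_ultralimit hX.isClosed (fun k => hX.shift_mem _ _ (hy k)) hy', ?_, ?_⟩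
  · intro hxy
    obtain ⟨k, h1, h2⟩ := ((hx' 0).and (hy' 0)).exists
    rw [← hxy, ← h1] at h2
    simp only [shift, zero_add] at h2
    exact hne k h2.symm
  · intro n hn
    have hinv : Tendsto (fun k => (R k)⁻¹) U (𝓝 0) := by
      refine tendsto_inv_atTop_zero.comp (Tendsto.mono_left ?_ hU)
      exact tendsto_atTop_mono hRk tendsto_natCast_atTop_atTop
    -- This is `(|n + q|² - |q|²) / |q|`; a negative limit puts `n + q` eventually inside the disc.
    have hlim : Tendsto (fun k => (N n : ℝ) * (R k)⁻¹ +
        2 * (n.1 * ((q k).1 / R k) + n.2 * ((q k).2 / R k))) U (𝓝 (N n * 0 + 2 * L n)) := by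
      rw [hLdef]
      exact (hinv.const_mul _).add
        (((hα.const_mul _).add (hβ.const_mul _)).const_mul _)
    have hev := hlim.eventually_lt_const (by linarith : N n * 0 + 2 * L n < 0)
    obtain ⟨k, h1, h2, h3, h4⟩ := ((hx' n).and ((hy' n).and (hev.and (hU hRpos)))).exists
    rw [← h1, ← h2]
    apply heq k
    have h5 : (N n : ℝ) + 2 * (n.1 * (q k).1 + n.2 * (q k).2) < 0 := by
      have : (N n : ℝ) * (R k)⁻¹ + 2 * (n.1 * ((q k).1 / R k) + n.2 * ((q k).2 / R k)) =
        ((N n : ℝ) + 2 * (n.1 * (q k).1 + n.2 * (q k).2)) / R k := by ring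
      rw [this] at h3
      by_contra hcon
      exact absurd h3 (not_lt.2 (div_nonneg (not_lt.1 hcon) h4.le))
    rw [hNR] at h5
    have h6 : n.1 ^ 2 + n.2 ^ 2 + 2 * (n.1 * (q k).1 + n.2 * (q k).2) < 0 := by exact_mod_cast h5
    zify
    rw [hN, hN]
    simp only [Prod.fst_add, Prod.snd_add]
    nlinarith

end Topological


/-! ### Asymptotic pairs on both sides of a horizontal line -/

section Flip

variable {A : Type*}

/-- Two configurations are related if their difference is horizontally `p`-periodic. -/
def PeriodicDiff (e : A → ℤ) (p : ℕ) (x y : Config A) : Prop :=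
  ∀ n, e (x (n + ((p : ℤ), 0))) - e (y (n + ((p : ℤ), 0))) = e (x n) - e (y n)

theorem PeriodicDiff.symm {e : A → ℤ} {p : ℕ} {x y : Config A} (h : PeriodicDiff e p x y) :
    PeriodicDiff e p y x := fun n => by linarith [h n]

theorem PeriodicDiff.trans {e : A → ℤ} {p : ℕ} {x y z : Config A} (h : PeriodicDiff e p x y)
    (h' : PeriodicDiff e p y z) : PeriodicDiff e p x z := fun n => by linarith [h n, h' n]

theorem PeriodicDiff.shift {e : A → ℤ} {p : ℕ} {x y : Config A} (h : PeriodicDiff e p x y)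
    (t : ℤ × ℤ) : PeriodicDiff e p (shift t x) (shift t y) := fun n => by
  have := h (n + t)
  rw [add_right_comm] at this
  exact this

theorem PeriodicDiff.ultralimit {e : A → ℤ} {p : ℕ} {U : Ultrafilter ℕ} {x y : ℕ → Config A}
    {x' y' : Config A} (hx : ∀ n, ∀ᶠ k in U, x k n = x' n) (hy : ∀ n, ∀ᶠ k in U, y k n = y' n)
    (h : ∀ k, PeriodicDiff e p (x k) (y k)) : PeriodicDiff e p x' y' := by
  intro n
  obtain ⟨k, h1, h2, h3, h4⟩ :=
    ((hx n).and ((hy n).and ((hx (n + ((p : ℤ), 0))).and (hy (n + ((p : ℤ), 0)))))).exists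
  rw [← h1, ← h2, ← h3, ← h4]
  exact h k n

/-- Agreement of related configurations within a row is decided on one period. -/
theorem PeriodicDiff.eq_of_eq_mod {e : A → ℤ} (he : Function.Injective e) {p : ℕ}
    {x y : Config A} (h : PeriodicDiff e p x y) {n : ℤ × ℤ}
    (hn : x (n.1 % p, n.2) = y (n.1 % p, n.2)) : x n = y n := by
  have hper : Function.Periodic (fun i : ℤ => e (x (i, n.2)) - e (y (i, n.2))) (p : ℤ) := by
    intro i
    have := h (i, n.2)
    simpa using this
  have h1 := hper.int_mul (n.1 / p) (n.1 % p)
  simp only [hn, sub_self, mul_comm (n.1 / (p : ℤ)), Int.cast_id, Int.emod_add_mul_ediv] at h1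
  exact he (sub_eq_zero.1 h1)

/-- `X` contains two distinct elements that agree on a lower half-plane. -/
def AsymptoticBelow (X : Set (Config A)) : Prop :=
  ∃ x ∈ X, ∃ y ∈ X, x ≠ y ∧ ∀ n : ℤ × ℤ, n.2 < 0 → x n = y n

/-- `X` contains two distinct elements that agree on an upper half-plane. -/
def AsymptoticAbove (X : Set (Config A)) : Prop :=
  ∃ x ∈ X, ∃ y ∈ X, x ≠ y ∧ ∀ n : ℤ × ℤ, 0 < n.2 → x n = y n

/-- Any two members of the tuple `T` differ somewhere in the rows `j, …, j + k - 1`. -/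
def Separated {I : Type*} (T : I → Config A) (k : ℕ) (j : ℤ) : Prop :=
  ∀ a b, a ≠ b → ∃ n : ℤ × ℤ, j ≤ n.2 ∧ n.2 < j + k ∧ T a n ≠ T b n

theorem Separated.ultralimit {I : Type*} {e : A → ℤ} (he : Function.Injective e) {p : ℕ}
    (hp : 0 < p) {k : ℕ} {j : ℤ} {U : Ultrafilter ℕ} {T : ℕ → I → Config A} {T' : I → Config A}
    (hT : ∀ a n, ∀ᶠ m in U, T m a n = T' a n) (h : ∀ m a b, PeriodicDiff e p (T m a) (T m b))
    (hs : ∀ᶠ m in U, Separated (T m) k j) : Separated T' k j := by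
  intro a b hab
  by_contra! hcon
  have hwin : ∀ᶠ m in U, ∀ n ∈ Finset.Ico (0 : ℤ) p ×ˢ Finset.Ico j (j + k),
      T m a n = T m b n := by
    rw [eventually_all_finset]
    intro n hn
    rw [Finset.mem_product, Finset.mem_Ico, Finset.mem_Ico] at hn
    filter_upwards [hT a n, hT b n] with m h1 h2
    rw [h1, h2, hcon n hn.2.1 hn.2.2]
  obtain ⟨m, h1, h2⟩ := (hwin.and hs).exists
  obtain ⟨n, hn1, hn2, hn⟩ := h2 a b hab
  refine hn ((h m a b).eq_of_eq_mod he (h1 _ ?_))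
  rw [Finset.mem_product, Finset.mem_Ico, Finset.mem_Ico]
  exact ⟨⟨Int.emod_nonneg _ (by omega), Int.emod_lt_of_pos _ (by omega)⟩, hn1, hn2⟩

variable [TopologicalSpace A] [DiscreteTopology A] [Finite A] {X : Set (Config A)}

/-- If no two distinct elements agree on an upper half-plane, then the contents of some finite
number of rows determine everything below. -/
theorem exists_strip_determines_below (hX : IsMinimalSubshift X) (h : ¬ AsymptoticAbove X) :
    ∃ k : ℕ, ∀ x ∈ X, ∀ y ∈ X, ∀ j : ℤ, (∀ n : ℤ × ℤ, j ≤ n.2 → n.2 < j + k → x n = y n) →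
      ∀ n : ℤ × ℤ, n.2 < j + k → x n = y n := by
  -- Compactness: counterexamples for all `k` would have a limit pair that differs at the origin and
  -- agrees on all rows above it.
  have h1 : ∃ k : ℕ, ∀ x ∈ X, ∀ y ∈ X, (∀ n : ℤ × ℤ, 0 < n.2 → n.2 ≤ k → x n = y n) →
      x 0 = y 0 := by
    by_contra! hcon
    choose x hx y hy heq hne using hcon
    obtain ⟨x', hx'⟩ := exists_ultralimit (hyperfilter ℕ) x
    obtain ⟨y', hy'⟩ := exists_ultralimit (hyperfilter ℕ) y
    refine h ⟨x', mem_of_ultralimit hX.isClosed hx hx', y', mem_of_ultralimit hX.isClosed hy hy',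
      fun hxy => ?_, fun n hn => ?_⟩
    · obtain ⟨k, h1, h2⟩ := ((hx' 0).and (hy' 0)).exists
      exact hne k (by rw [h1, h2, hxy])
    · have hlarge : ∀ᶠ k : ℕ in hyperfilter ℕ, n.2.toNat ≤ k := by
        refine hyperfilter_le_cofinite ?_
        rw [Nat.cofinite_eq_atTop]
        exact eventually_ge_atTop _
      obtain ⟨k, h1, h2, h3⟩ := ((hx' n).and ((hy' n).and hlarge)).exists
      rw [← h1, ← h2]
      exact heq k n hn (by omega)
  obtain ⟨k, hk⟩ := h1
  refine ⟨k, fun x hx y hy j hxy => ?_⟩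
  have key : ∀ d : ℕ, ∀ n : ℤ × ℤ, j - d ≤ n.2 → n.2 < j + k → x n = y n := by
    intro d
    induction d with
    | zero => simpa using hxy
    | succ d ih =>
      intro n hn1 hn2
      by_cases hn : j - d ≤ n.2
      · exact ih n hn hn2
      · have := hk _ (hX.shift_mem n x hx) _ (hX.shift_mem n y hy) (fun i hi1 hi2 => by
          apply ih <;> simp only [Prod.snd_add] <;> push_cast at hn1 <;> omega)
        simpa [shift] using this
  exact fun n hn => key (j - n.2).toNat n (by omega) hn

/-- In a minimal subshift in which pairs asymptotic below have periodic differences, the existence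
of pairs asymptotic below implies the existence of pairs asymptotic above. -/
theorem AsymptoticBelow.above (hX : IsMinimalSubshift X) {e : A → ℤ} (he : Function.Injective e)
    {p : ℕ} (hp : 0 < p)
    (hper : ∀ x ∈ X, ∀ y ∈ X, (∀ n : ℤ × ℤ, n.2 < 0 → x n = y n) → PeriodicDiff e p x y)
    (h : AsymptoticBelow X) : AsymptoticAbove X := by
  classical
  by_contra hab
  obtain ⟨k, hk⟩ := exists_strip_determines_below hX hab
  obtain ⟨x, hx, y, hy, hxy, hbelow⟩ := h
  -- A tuple of maximal size is made to contain `x` and is then enlarged by `y`, a contradiction.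
  let P : ℕ → Prop := fun R => ∃ T : Fin R → Config A, (∀ a, T a ∈ X) ∧
    (∀ a b, PeriodicDiff e p (T a) (T b)) ∧ Function.Injective T
  have hsep : ∀ R (T : Fin R → Config A), (∀ a, T a ∈ X) → Function.Injective T →
      ∃ J : ℤ, ∀ j, J ≤ j → Separated T k j := by
    intro R T hT hinj
    have : ∀ q : Fin R × Fin R, ∃ n : ℤ × ℤ, q.1 ≠ q.2 → T q.1 n ≠ T q.2 n := by
      intro q
      by_cases hq : q.1 = q.2
      · exact ⟨0, fun h => absurd hq h⟩
      · obtain ⟨n, hn⟩ := Function.ne_iff.1 (hinj.ne hq)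
        exact ⟨n, fun _ => hn⟩
    choose f hf using this
    obtain ⟨J, hJ⟩ := (Set.finite_range fun q => (f q).2).bddAbove
    refine ⟨J + 1, fun j hj a b hab => ?_⟩
    by_contra! hcon
    refine hf (a, b) hab (hk _ (hT a) _ (hT b) j hcon _ ?_)
    have : (f (a, b)).2 ≤ J := hJ ⟨(a, b), rfl⟩
    omega
  have : Fintype A := Fintype.ofFinite A
  -- A strip of `k` rows far enough up separates the tuple, and one horizontal period of it
  -- suffices, so blocks of size `p × k` tell the members apart.
  have hbound : ∀ R, P R → R ≤ Fintype.card (Fin p × Fin k → A) := by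
    rintro R ⟨T, hT, hrel, hinj⟩
    obtain ⟨J, hJ⟩ := hsep R T hT hinj
    rw [← Fintype.card_fin R]
    refine Fintype.card_le_of_injective
      (fun (a : Fin R) (i : Fin p × Fin k) => T a ((i.1 : ℤ), J + (i.2 : ℤ))) fun a b hab => ?_
    by_contra hne
    obtain ⟨n, hn1, hn2, hn⟩ := hJ J le_rfl a b hne
    refine hn ((hrel a b).eq_of_eq_mod he ?_)
    have h0 := Int.emod_nonneg n.1 (show (p : ℤ) ≠ 0 by omega)
    have h1 := Int.emod_lt_of_pos n.1 (show (0 : ℤ) < p by omega)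
    have h2 := congrFun hab (⟨(n.1 % p).toNat, by omega⟩, ⟨(n.2 - J).toNat, by omega⟩)
    simp only [Int.toNat_of_nonneg h0, Int.toNat_of_nonneg (show 0 ≤ n.2 - J by omega),
      add_sub_cancel] at h2
    exact h2
  have hP1 : P 1 :=
    ⟨fun _ => x, fun _ => hx, fun _ _ _ => by simp, fun _ _ _ => Subsingleton.elim _ _⟩
  obtain ⟨R, hR1, hPR, hPR'⟩ : ∃ R, 1 ≤ R ∧ P R ∧ ¬ P (R + 1) := by
    refine ⟨Nat.findGreatest P (Fintype.card (Fin p × Fin k → A)),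
      Nat.le_findGreatest (hbound 1 hP1) hP1, Nat.findGreatest_spec (hbound 1 hP1) hP1,
      fun hcon => ?_⟩
    exact Nat.findGreatest_is_greatest (Nat.lt_succ_self _) (hbound _ hcon) hcon
  obtain ⟨T, hT, hrel, hinj⟩ := hPR
  obtain ⟨J, hJ⟩ := hsep R T hT hinj
  let U : Ultrafilter ℕ := hyperfilter ℕ
  have hU : ∀ m₀ : ℕ, ∀ᶠ m in U, m₀ ≤ m := fun m₀ => by
    refine hyperfilter_le_cofinite ?_
    rw [Nat.cofinite_eq_atTop]
    exact eventually_ge_atTop _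
  -- Upward shifts extend the separation, known only from row `J` on, to every strip of `k` rows.
  choose T₁ hT₁ using fun a => exists_ultralimit U fun m : ℕ => shift (0, J + m) (T a)
  have hT₁X : ∀ a, T₁ a ∈ X := fun a =>
    mem_of_ultralimit hX.isClosed (fun m => hX.shift_mem _ _ (hT a)) (hT₁ a)
  have hT₁rel : ∀ a b, PeriodicDiff e p (T₁ a) (T₁ b) := fun a b =>
    PeriodicDiff.ultralimit (hT₁ a) (hT₁ b) fun m => (hrel a b).shift _
  have hT₁sep : ∀ j, Separated T₁ k j := fun j => by
    refine Separated.ultralimit he hp (T := fun m a => shift (0, J + m) (T a)) hT₁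
      (fun m a b => (hrel a b).shift _) ?_
    filter_upwards [hU (-j).toNat] with m hm a b hab
    obtain ⟨n, hn1, hn2, hn⟩ := hJ (j + (J + m)) (by omega) a b hab
    refine ⟨n - (0, J + m), ?_, ?_, ?_⟩
    · simp only [Prod.snd_sub]; omega
    · simp only [Prod.snd_sub]; omega
    · simpa [shift] using hn
  let a₀ : Fin R := ⟨0, hR1⟩
  -- Recurrence moves the member `a₀` to `x` in the limit; separation on all strips survives these
  -- uncontrolled shifts.
  have ht : ∀ m : ℕ, ∃ t, ∀ n ∈ Finset.Icc (-(m : ℤ)) m ×ˢ Finset.Icc (-(m : ℤ)) m,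
      T₁ a₀ (n + t) = x n := fun m => hX.recurrent _ (hT₁X a₀) _ hx _
  choose t ht using ht
  choose T₂ hT₂ using fun a => exists_ultralimit U fun m : ℕ => shift (t m) (T₁ a)
  have hT₂X : ∀ a, T₂ a ∈ X := fun a =>
    mem_of_ultralimit hX.isClosed (fun m => hX.shift_mem _ _ (hT₁X a)) (hT₂ a)
  have hT₂rel : ∀ a b, PeriodicDiff e p (T₂ a) (T₂ b) := fun a b =>
    PeriodicDiff.ultralimit (hT₂ a) (hT₂ b) fun m => (hT₁rel a b).shift _
  have hT₂sep : Separated T₂ k (-k) := by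
    refine Separated.ultralimit he hp (T := fun m a => shift (t m) (T₁ a)) hT₂
      (fun m a b => (hT₁rel a b).shift _) (Eventually.of_forall fun m a b hab => ?_)
    obtain ⟨n, hn1, hn2, hn⟩ := hT₁sep (-k + (t m).2) a b hab
    refine ⟨n - t m, ?_, ?_, ?_⟩
    · simp only [Prod.snd_sub]; omega
    · simp only [Prod.snd_sub]; omega
    · simpa [shift] using hn
  have hT₂x : T₂ a₀ = x := by
    funext n
    obtain ⟨m, h1, h2⟩ := ((hT₂ a₀ n).and (hU (max n.1.natAbs n.2.natAbs))).exists
    rw [← h1]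
    refine ht m n ?_
    rw [Finset.mem_product, Finset.mem_Icc, Finset.mem_Icc]
    omega
  have hyx : ∀ a, PeriodicDiff e p y (T₂ a) := fun a =>
    (hper x hx y hy hbelow).symm.trans (hT₂x ▸ hT₂rel a₀ a)
  -- The other members differ from `x` within the rows `-k, …, -1`, where `y` agrees with `x`; so
  -- `y` is new.
  refine hPR' ⟨Fin.cons y T₂, ?_, ?_, ?_⟩
  · intro a
    refine Fin.cases ?_ (fun a => ?_) a
    · simpa using hy
    · simpa using hT₂X a
  · intro a b
    refine Fin.cases ?_ (fun a => ?_) a <;> refine Fin.cases ?_ (fun b => ?_) b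
    · intro n; simp
    · simpa using hyx b
    · simpa using (hyx a).symm
    · simpa using hT₂rel a b
  · have hdiff : ∀ a b, a ≠ b → T₂ a ≠ T₂ b := fun a b hab heq => by
      obtain ⟨n, -, -, hn⟩ := hT₂sep a b hab
      exact hn (congrFun heq n)
    rw [Fin.cons_injective_iff]
    refine ⟨?_, fun a b h => by_contra fun hne => hdiff a b hne h⟩
    rintro ⟨a, ha⟩
    by_cases haa : a = a₀
    · rw [haa, hT₂x] at ha
      exact hxy ha
    · obtain ⟨n, -, hn2, hn⟩ := hT₂sep a a₀ haa
      rw [ha, hT₂x] at hn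
      exact hn (hbelow n (by omega)).symm

end Flip


/-! ### Convex sets of cells -/

/-- A finite set of cells is convex if every cell outside of it is separated from it by an
integer half-plane. -/
def IntConvex (S : Finset (ℤ × ℤ)) : Prop :=
  ∀ p ∉ S, ∃ α β γ : ℤ, γ < α * p.1 + β * p.2 ∧ ∀ s ∈ S, α * s.1 + β * s.2 ≤ γ

namespace IntConvex

variable {S : Finset (ℤ × ℤ)}

theorem filter_row_ne (hS : IntConvex S) {T : ℤ} (hT : ∀ s ∈ S, s.2 ≤ T) :
    IntConvex (S.filter fun s => s.2 ≠ T) := by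
  intro p hp
  by_cases hpS : p ∈ S
  · have hpT : p.2 = T := by
      by_contra h
      exact hp (Finset.mem_filter.2 ⟨hpS, h⟩)
    refine ⟨0, 1, T - 1, by omega, fun s hs => ?_⟩
    rw [Finset.mem_filter] at hs
    have := hT s hs.1
    omega
  · obtain ⟨α, β, γ, h1, h2⟩ := hS p hpS
    exact ⟨α, β, γ, h1, fun s hs => h2 s (Finset.mem_filter.1 hs).1⟩

/-- The functional with weights `σ` and a large `N` is a slight tilt of the height, with `(c, T)` as
its only maximizer on `S`. The sign `σ` selects the right or the left end of the top row. -/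
theorem erase_corner (hS : IntConvex S) {T c σ : ℤ} (hσ : σ = 1 ∨ σ = -1)
    (hT : ∀ s ∈ S, s.2 ≤ T)
    (hc : ∀ s ∈ S, s.2 = T → σ * s.1 ≤ σ * c) : IntConvex (S.erase (c, T)) := by
  intro p hp
  by_cases hpS : p ∈ S
  · have hpc : p = (c, T) := by
      by_contra h
      exact hp (Finset.mem_erase.2 ⟨h, hpS⟩)
    set N : ℤ := ∑ s ∈ S, |s.1| + |c| + 1 with hN
    have hle : ∀ s ∈ S, |s.1| ≤ ∑ s ∈ S, |s.1| := fun s hs =>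
      Finset.single_le_sum (f := fun s : ℤ × ℤ => |s.1|) (fun _ _ => abs_nonneg _) hs
    refine ⟨σ, N, σ * c + N * T - 1, by rw [hpc]; simp, fun s hs => ?_⟩
    rw [Finset.mem_erase] at hs
    have h1 := hT s hs.2
    rcases h1.eq_or_lt with h | h
    · have h2 := hc s hs.2 h
      have h3 : s.1 ≠ c := fun h' => hs.1 (Prod.ext h' h)
      rw [h]
      rcases hσ with rfl | rfl <;> omega
    · have h2 := abs_le.1 (hle s hs.2)
      have h3 := neg_abs_le c
      have h4 := le_abs_self c
      have h5 : N * s.2 ≤ N * (T - 1) :=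
        mul_le_mul_of_nonneg_left (by omega) (by have := hle s hs.2; have := abs_nonneg s.1
                                                 have := abs_nonneg c; omega)
      rw [mul_sub, mul_one] at h5
      rcases hσ with rfl | rfl <;> linarith [h2.1, h2.2]
  · obtain ⟨α, β, γ, h1, h2⟩ := hS p hpS
    exact ⟨α, β, γ, h1, fun s hs => h2 s (Finset.mem_erase.1 hs).2⟩

theorem mem_of_between (hS : IntConvex S) {l i r T : ℤ} (hl : (l, T) ∈ S) (hr : (r, T) ∈ S)
    (hli : l ≤ i) (hir : i ≤ r) : (i, T) ∈ S := by
  by_contra h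
  obtain ⟨α, β, γ, h1, h2⟩ := hS _ h
  have h3 := h2 _ hl
  have h4 := h2 _ hr
  simp only at h1 h3 h4
  rcases le_total 0 α with hα | hα
  · nlinarith
  · nlinarith

/-- A row between two horizontal segments of length at least `len` in a convex set has at least
`len` cells. -/
theorem le_card_row (hS : IntConvex S) {l r l' r' T b j : ℤ} {len : ℕ} (hl : (l, T) ∈ S)
    (hr : (r, T) ∈ S) (hl' : (l', b) ∈ S) (hr' : (r', b) ∈ S) (hlen : l + len ≤ r)
    (hlen' : l' + len ≤ r') (hbj : b ≤ j) (hjT : j < T) :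
    len ≤ (S.filter fun s => s.2 = j).card := by
  set k := T - b with hk
  have hk0 : 0 < k := by omega
  -- At height `j` the parallelogram on the segments `[l', l' + len]` and `[l, l + len]` has the
  -- slice `[w / k, w / k + len]`; denominators are cleared throughout.
  set w := l' * (T - j) + l * (j - b) with hw
  have hmem : ∀ t : ℤ, w ≤ k * t → k * t ≤ w + k * len → (t, j) ∈ S := by
    intro t ht1 ht2
    by_contra h
    obtain ⟨α, β, γ, h1, h2⟩ := hS _ h
    have e1 := h2 _ hl
    have e2 := h2 _ hr
    have e3 := h2 _ hl'
    have e4 := h2 _ hr'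
    simp only at h1 e1 e2 e3 e4
    have hjb : 0 ≤ j - b := by omega
    have hTj : 0 ≤ T - j := by omega
    have hkj : β * j * k = β * b * (T - j) + β * T * (j - b) := by rw [hk]; ring
    have hγ : γ * k = γ * (T - j) + γ * (j - b) := by rw [hk]; ring
    have hbig : γ * k < (α * t + β * j) * k := mul_lt_mul_of_pos_right h1 hk0
    rcases le_total 0 α with hα | hα
    · have f1 : α * (l + len) + β * T ≤ γ := by nlinarith
      have f2 : α * (l' + len) + β * b ≤ γ := by nlinarith
      have f3 := mul_le_mul_of_nonneg_right f1 hjb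
      have f4 := mul_le_mul_of_nonneg_right f2 hTj
      have f5 := mul_le_mul_of_nonneg_left ht2 hα
      have f6 : α * (w + k * len) = α * (l' + len) * (T - j) + α * (l + len) * (j - b) := by
        rw [hw, hk]; ring
      linarith
    · have f3 := mul_le_mul_of_nonneg_right e1 hjb
      have f4 := mul_le_mul_of_nonneg_right e3 hTj
      have f5 := mul_le_mul_of_nonpos_left ht1 hα
      have f6 : α * w = α * l' * (T - j) + α * l * (j - b) := by
        rw [hw]; ring
      linarith
  -- The ceiling of `w / k`; the `len` integers starting here all lie in the slice.
  set t₀ := -((-w) / k) with ht₀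
  have hm1 := Int.emod_add_mul_ediv (-w) k
  have hm2 := Int.emod_nonneg (-w) hk0.ne'
  have hm3 := Int.emod_lt_of_pos (-w) hk0
  have ht1 : k * t₀ = w + (-w) % k := by rw [ht₀, mul_neg]; linarith
  have hsub : (Finset.Ico t₀ (t₀ + len)).image (fun t => (t, j)) ⊆ S.filter fun s => s.2 = j := by
    intro p hp
    obtain ⟨t, ht, rfl⟩ := Finset.mem_image.1 hp
    rw [Finset.mem_Ico] at ht
    refine Finset.mem_filter.2 ⟨hmem t ?_ ?_, rfl⟩
    · have := mul_le_mul_of_nonneg_left ht.1 hk0.le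
      linarith
    · have h3 : t + 1 ≤ t₀ + len := by omega
      have := mul_le_mul_of_nonneg_left h3 hk0.le
      rw [mul_add, mul_add, mul_one] at this
      linarith
  have := Finset.card_le_card hsub
  rwa [Finset.card_image_of_injective _ (fun a b h => (Prod.ext_iff.1 h).1), Int.card_Ico,
    add_sub_cancel_left, Int.toNat_natCast] at this

end IntConvex

/-! ### Pattern counting and generating sets -/

/-- The number of values with several preimages is at most the number of elements minus the
number of values. -/
theorem ncard_add_ncard_image_le {α β : Type*} (f : α → β) {s : Set α} (hs : s.Finite) (Q : Set β)
    (hQ : ∀ q ∈ Q, ∃ a ∈ s, ∃ b ∈ s, a ≠ b ∧ f a = q ∧ f b = q) :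
    Q.ncard + (f '' s).ncard ≤ s.ncard := by
  classical
  lift s to Finset α using hs
  have hQs : Q ⊆ ↑(s.image f) := fun q hq => by
    obtain ⟨a, ha, -, -, -, h, -⟩ := hQ q hq
    exact Finset.mem_coe.2 (Finset.mem_image.2 ⟨a, ha, h⟩)
  lift Q to Finset β using (Finset.finite_toSet _).subset hQs
  rw [← Finset.coe_image, Set.ncard_coe_finset, Set.ncard_coe_finset, Set.ncard_coe_finset,
    Finset.card_eq_sum_card_image f s]
  have hQs' : (s.image f).filter (· ∈ Q) = Q := by
    ext q
    rw [Finset.mem_filter]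
    exact ⟨fun h => h.2, fun h => ⟨Finset.mem_coe.1 (hQs h), h⟩⟩
  calc Q.card + (s.image f).card = ∑ b ∈ s.image f, ((if b ∈ Q then 1 else 0) + 1) := by
        rw [Finset.sum_add_distrib, Finset.card_eq_sum_ones (s.image f), ← Finset.sum_filter, hQs',
          Finset.card_eq_sum_ones Q]
    _ ≤ _ := Finset.sum_le_sum fun b hb => by
        split_ifs with h
        · obtain ⟨a, ha, a', ha', hne, h1, h2⟩ := hQ b h
          exact Finset.one_lt_card.2 ⟨a, Finset.mem_filter.2 ⟨ha, h1⟩, a',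
            Finset.mem_filter.2 ⟨ha', h2⟩, hne⟩
        · obtain ⟨a, ha, h1⟩ := Finset.mem_image.1 hb
          exact Finset.card_pos.2 ⟨a, Finset.mem_filter.2 ⟨ha, h1⟩⟩

section Patterns

variable {A : Type*} {X : Set (Config A)} {S S' : Finset (ℤ × ℤ)}

theorem patternSet_eq_image (h : S' ⊆ S) :
    patternSet X S' = (fun (q : S → A) (s : S') => q ⟨s, h s.2⟩) '' patternSet X S := by
  rw [patternSet, patternSet, Set.image_image]

/-- Restriction of patterns from `S` to `S'` is surjective, so by the count it is also injective. -/
theorem eqOn_of_ncard_le [Finite A] (h : S' ⊆ S)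
    (hcard : (patternSet X S).ncard ≤ (patternSet X S').ncard) {x y : Config A} (hx : x ∈ X)
    (hy : y ∈ X) (hxy : ∀ s ∈ S', x s = y s) : ∀ s ∈ S, x s = y s := by
  have himg := patternSet_eq_image (X := X) h
  have hinj := (Set.ncard_image_iff (s := patternSet X S) (Set.toFinite _)
    (f := fun (q : S → A) (s : S') => q ⟨s, h s.2⟩)).1
    (le_antisymm (Set.ncard_image_le (Set.toFinite _)) (by rwa [← himg]))
  intro s hs
  exact congrFun (hinj ⟨x, hx, rfl⟩ ⟨y, hy, rfl⟩ (funext fun s => hxy s s.2)) ⟨s, hs⟩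

/-- `S` is a smallest convex set with at most `|S|` patterns. -/
structure IsGenerating (X : Set (Config A)) (S : Finset (ℤ × ℤ)) : Prop where
  convex : IntConvex S
  ncard_le : (patternSet X S).ncard ≤ S.card
  lt_ncard : ∀ S' : Finset (ℤ × ℤ), S'.card < S.card → IntConvex S' →
    S'.card < (patternSet X S').ncard

theorem exists_isGenerating {D : Finset (ℤ × ℤ)} (hD : IntConvex D)
    (h : (patternSet X D).ncard ≤ D.card) : ∃ S, IsGenerating X S := by
  classical
  have hex : ∃ m, ∃ S : Finset (ℤ × ℤ), S.card = m ∧ IntConvex S ∧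
      (patternSet X S).ncard ≤ S.card := ⟨_, D, rfl, hD, h⟩
  obtain ⟨S, hcard, h1, h2⟩ := Nat.find_spec hex
  refine ⟨S, h1, h2, fun S' hlt hS' => ?_⟩
  by_contra! hcon
  exact Nat.find_min hex (by rwa [hcard] at hlt) ⟨S', rfl, hS', hcon⟩

theorem IsGenerating.nonempty [Finite A] (hX : X.Nonempty) (hS : IsGenerating X S) :
    S.Nonempty := by
  rw [Finset.nonempty_iff_ne_empty]
  rintro rfl
  have h1 := hS.ncard_le
  rw [Finset.card_empty, Nat.le_zero, Set.ncard_eq_zero (Set.toFinite _), patternSet,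
    Set.image_eq_empty] at h1
  exact hX.ne_empty h1

/-- The end cells of the top row are determined by the rest of the generating set. -/
theorem IsGenerating.eq_corner [Finite A] (hS : IsGenerating X S) {T c σ : ℤ}
    (hσ : σ = 1 ∨ σ = -1) (hT : ∀ s ∈ S, s.2 ≤ T) (hcS : (c, T) ∈ S)
    (hc : ∀ s ∈ S, s.2 = T → σ * s.1 ≤ σ * c) {x y : Config A} (hx : x ∈ X) (hy : y ∈ X)
    (hxy : ∀ s ∈ S, s ≠ (c, T) → x s = y s) : x (c, T) = y (c, T) := by
  have hlt := Finset.card_erase_lt_of_mem hcS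
  -- Minimality of `S` gives the erased set at least `|S|` patterns, hence no fewer than `S` has.
  have h1 := hS.lt_ncard _ hlt (hS.convex.erase_corner hσ hT hc)
  have h2 := Finset.card_erase_add_one hcS
  refine eqOn_of_ncard_le (Finset.erase_subset (c, T) S) (hS.ncard_le.trans (by omega)) hx hy
    (fun s hs => ?_) _ hcS
  rw [Finset.mem_erase] at hs
  exact hxy s hs.2 hs.1

end Patterns


/-! ### Periodic strips from asymptotic pairs -/

section Strip

variable {A : Type*} {X : Set (Config A)} {S : Finset (ℤ × ℤ)}

theorem AsymptoticBelow.exists_ne_row [TopologicalSpace A] (hX : IsMinimalSubshift X)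
    (h : AsymptoticBelow X) : ∃ x ∈ X, ∃ y ∈ X, (∀ n : ℤ × ℤ, n.2 < 0 → x n = y n) ∧
      ∃ i : ℤ, x (i, 0) ≠ y (i, 0) := by
  classical
  obtain ⟨x, hx, y, hy, hxy, hbelow⟩ := h
  have hex : ∃ m : ℕ, ∃ i : ℤ, x (i, (m : ℤ)) ≠ y (i, (m : ℤ)) := by
    obtain ⟨n, hn⟩ := Function.ne_iff.1 hxy
    have : 0 ≤ n.2 := not_lt.1 fun h => hn (hbelow n h)
    exact ⟨n.2.toNat, n.1, by rwa [Int.toNat_of_nonneg this]⟩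
  obtain ⟨i, hi⟩ := Nat.find_spec hex
  refine ⟨shift (0, (Nat.find hex : ℤ)) x, hX.shift_mem _ _ hx,
    shift (0, (Nat.find hex : ℤ)) y, hX.shift_mem _ _ hy, fun n hn => ?_, i, by simpa [shift]⟩
  by_contra hne
  change x (n + (0, (Nat.find hex : ℤ))) ≠ y (n + (0, (Nat.find hex : ℤ))) at hne
  have h0 : 0 ≤ n.2 + (Nat.find hex : ℤ) := not_lt.1 fun h => hne (hbelow _ h)
  refine Nat.find_min hex (m := (n.2 + (Nat.find hex : ℤ)).toNat) (by omega) ⟨n.1, ?_⟩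
  rw [Int.toNat_of_nonneg h0]
  simpa [Prod.add_def] using hne

/-- Elements that agree below row `0` but not on row `0` differ on every translate of the top row
of a generating set along row `0`. -/
theorem IsGenerating.exists_ne_top [Finite A] [TopologicalSpace A] (hX : IsMinimalSubshift X)
    (hS : IsGenerating X S) {T l r : ℤ} (hT : ∀ s ∈ S, s.2 ≤ T) (hl : (l, T) ∈ S)
    (hr : (r, T) ∈ S) (hlr : ∀ s ∈ S, s.2 = T → l ≤ s.1 ∧ s.1 ≤ r) {x y : Config A} (hx : x ∈ X)
    (hy : y ∈ X) (hbelow : ∀ n : ℤ × ℤ, n.2 < 0 → x n = y n) {i₀ : ℤ}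
    (hi₀ : x (i₀, 0) ≠ y (i₀, 0)) (t : ℤ) : ∃ s ∈ S, s.2 = T ∧
      x (s + (t, -T)) ≠ y (s + (t, -T)) := by
  by_contra! hcon
  have hlr' : l ≤ r := (hlr _ hl rfl).2
  have hstep : ∀ (t' c σ : ℤ), (σ = 1 ∨ σ = -1) → (c, T) ∈ S →
      (∀ s ∈ S, s.2 = T → σ * s.1 ≤ σ * c) →
      (∀ s ∈ S, s.2 = T → s.1 ≠ c → x (s.1 + t', 0) = y (s.1 + t', 0)) →
      x (c + t', 0) = y (c + t', 0) := by
    intro t' c σ hσ hcS hc h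
    have := hS.eq_corner hσ hT hcS hc (hX.shift_mem (t', -T) _ hx) (hX.shift_mem (t', -T) _ hy)
      (fun s hs hne => by
        change x (s + (t', -T)) = y (s + (t', -T))
        rcases (hT s hs).eq_or_lt with hsT | hsT
        · have h1 := h s hs hsT fun h' => hne (Prod.ext h' hsT)
          rwa [show s + (t', -T) = (s.1 + t', 0) by ext <;> simp [hsT]]
        · exact hbelow _ (by simp only [Prod.snd_add]; omega))
    simpa [shift] using this
  -- Agreement on one translate of the top row spreads along row `0` in both directions, one cell at
  -- a time, as the end cells are determined by the rest of `S`.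
  have key : ∀ m : ℕ, ∀ i : ℤ, l + t - m ≤ i → i ≤ r + t + m → x (i, 0) = y (i, 0) := by
    intro m
    induction m with
    | zero =>
      intro i hi1 hi2
      have hmem : (i - t, T) ∈ S :=
        hS.convex.mem_of_between hl hr (by push_cast at hi1; omega) (by push_cast at hi2; omega)
      simpa using hcon _ hmem rfl
    | succ m ih =>
      intro i hi1 hi2
      push_cast at hi1 hi2
      by_cases h1 : i < l + t - m
      · have := hstep (t - m - 1) l (-1) (Or.inr rfl) hl
          (fun s hs h => by linarith [(hlr s hs h).1]) (fun s hs h hne => by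
            have := hlr s hs h
            exact ih _ (by omega) (by omega))
        rwa [show l + (t - m - 1) = i by omega] at this
      · by_cases h2 : r + t + m < i
        · have := hstep (t + m + 1) r 1 (Or.inl rfl) hr
            (fun s hs h => by linarith [(hlr s hs h).2]) (fun s hs h hne => by
              have := hlr s hs h
              exact ih _ (by omega) (by omega))
          rwa [show r + (t + m + 1) = i by omega] at this
        · exact ih i (by omega) (by omega)
  exact hi₀ (key ((i₀ - l - t).natAbs + (i₀ - r - t).natAbs) i₀ (by omega) (by omega))

/-- Along a row where asymptotic elements start to differ, few patterns of the generating set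
without its top row occur. -/
theorem IsGenerating.ncard_patternSet_lt [Finite A] [TopologicalSpace A]
    (hX : IsMinimalSubshift X)
    (hS : IsGenerating X S) {T l r : ℤ} (hT : ∀ s ∈ S, s.2 ≤ T) (hl : (l, T) ∈ S)
    (hr : (r, T) ∈ S) (hlr : ∀ s ∈ S, s.2 = T → l ≤ s.1 ∧ s.1 ≤ r) {x y : Config A} (hx : x ∈ X)
    (hy : y ∈ X) (hbelow : ∀ n : ℤ × ℤ, n.2 < 0 → x n = y n) {i₀ : ℤ}
    (hi₀ : x (i₀, 0) ≠ y (i₀, 0)) :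
    (patternSet (Set.range fun t : ℤ => shift (t, -T) x) (S.filter fun s => s.2 ≠ T)).ncard <
      (S.filter fun s => s.2 = T).card := by
  have hsub : (S.filter fun s => s.2 ≠ T) ⊆ S := Finset.filter_subset _ _
  -- Each pattern seen here has two extensions to `S`, one from `x` and one from `y`. As `S` has at
  -- most `|S|` patterns and the truncated set more than its size, fewer such patterns exist than
  -- top cells.
  have h1 := ncard_add_ncard_image_le
    (fun (q : S → A) (s : (S.filter fun s => s.2 ≠ T : Finset (ℤ × ℤ))) => q ⟨s, hsub s.2⟩)
    (s := patternSet X S) (Set.toFinite _)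
    (patternSet (Set.range fun t : ℤ => shift (t, -T) x) (S.filter fun s => s.2 ≠ T)) (by
      rintro _ ⟨_, ⟨t, rfl⟩, rfl⟩
      refine ⟨_, ⟨_, hX.shift_mem (t, -T) _ hx, rfl⟩, _, ⟨_, hX.shift_mem (t, -T) _ hy, rfl⟩, ?_,
        rfl, ?_⟩
      · obtain ⟨s, hs, -, hne⟩ := hS.exists_ne_top hX hT hl hr hlr hx hy hbelow hi₀ t
        exact fun h => hne (congrFun h ⟨s, hs⟩)
      · funext s
        have hs := Finset.mem_filter.1 s.2
        have := hT _ hs.1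
        exact (hbelow _ (by simp only [Prod.snd_add]; omega)).symm)
  rw [← patternSet_eq_image hsub] at h1
  have h2 : (S.filter fun s => s.2 ≠ T).card + (S.filter fun s => s.2 = T).card = S.card := by
    rw [add_comm]
    exact Finset.card_filter_add_card_filter_not _
  have h3 : 0 < (S.filter fun s => s.2 = T).card :=
    Finset.card_pos.2 ⟨(l, T), Finset.mem_filter.2 ⟨hl, rfl⟩⟩
  have h4 := hS.lt_ncard _ (by omega) (hS.convex.filter_row_ne hT)
  have h5 := hS.ncard_le
  omega

theorem ncard_patternSet_mono [Finite A] {S S' : Finset (ℤ × ℤ)} (h : S' ⊆ S) :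
    (patternSet X S').ncard ≤ (patternSet X S).ncard := by
  rw [patternSet_eq_image h]
  exact Set.ncard_image_le (Set.toFinite _)

/-- A row with few patterns is periodic. -/
theorem exists_row_period [Finite A] {e : A → ℤ} (he : Function.Injective e) {B : ℕ}
    (hB : ∀ a, |e a| ≤ B) (x : Config A) (T j : ℤ)
    (h : (patternSet (Set.range fun t : ℤ => shift (t, -T) x) (S.filter fun s => s.2 = j)).ncard ≤
      (S.filter fun s => s.2 = j).card) :
    ∃ Q : ℕ, 0 < Q ∧ ∀ t, x (t + Q, j - T) = x (t, j - T) := by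
  obtain ⟨a, κ, ⟨v, hv, hav⟩, hrel⟩ := exists_relation e _ (Set.range_nonempty _) _ h
  have hvj := (Finset.mem_filter.1 hv).2
  obtain ⟨Q, hQ, H⟩ := exists_recurrence_period
    ((S.filter fun s => s.2 = j).image Prod.fst) (fun i => a (i, j))
    ⟨v.1, Finset.mem_image_of_mem _ hv, by rwa [← hvj]⟩ B
  refine ⟨Q, hQ, fun t => he ?_⟩
  refine H (fun t => e (x (t, j - T))) κ (fun t => hB _) (fun t => ?_) t
  rw [← hrel _ ⟨t, rfl⟩, Finset.sum_image]
  · refine Finset.sum_congr rfl fun v hv => ?_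
    have hvj := (Finset.mem_filter.1 hv).2
    rw [show (v.1, j) = v from Prod.ext rfl hvj.symm]
    congr 3
    ext
    · simp [add_comm]
    · simp [hvj, sub_eq_add_neg]
  · intro v hv w hw hvw
    exact Prod.ext hvw ((Finset.mem_filter.1 hv).2.trans (Finset.mem_filter.1 hw).2.symm)

theorem exists_common_row_period (x : Config A) (F : Finset ℤ)
    (h : ∀ j ∈ F, ∃ Q : ℕ, 0 < Q ∧ ∀ t, x (t + Q, j) = x (t, j)) :
    ∃ Q : ℕ, 0 < Q ∧ ∀ j ∈ F, Function.Periodic (fun t : ℤ => x (t, j)) (Q : ℤ) := by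
  classical
  induction F using Finset.induction_on with
  | empty => exact ⟨1, one_pos, by simp⟩
  | insert j F hj ih =>
    obtain ⟨Q, hQ, H⟩ := ih fun i hi => h i (Finset.mem_insert_of_mem hi)
    obtain ⟨Q', hQ', H'⟩ := h j (Finset.mem_insert_self _ _)
    refine ⟨Q * Q', Nat.mul_pos hQ hQ', fun i hi => ?_⟩
    rcases Finset.mem_insert.1 hi with rfl | hi
    · have : Function.Periodic (fun t : ℤ => x (t, i)) (Q' : ℤ) := H'
      simpa using this.nat_mul Q
    · simpa [mul_comm] using (H i hi).nat_mul Q'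

/-- An affine relation propagates horizontal periodicity of a strip to the half-plane above it. -/
theorem exists_period_above {e : A → ℤ} (he : Function.Injective e) {B : ℕ}
    (hB : ∀ a, |e a| ≤ B) {T b : ℤ} (hT : ∀ s ∈ S, b ≤ s.2 ∧ s.2 ≤ T) {a : ℤ × ℤ → ℤ} {κ : ℤ}
    (ha : ∃ v ∈ S, a v ≠ 0) {x : Config A}
    (hrel : ∀ t, ∑ v ∈ S, a v * e (shift t x v) = κ) {q₀ : ℕ} (hq₀ : 0 < q₀)
    (hx : ∀ j ∈ Finset.Ico (b - T) 0, Function.Periodic (fun t : ℤ => x (t, j)) (q₀ : ℤ)) :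
    ∃ q : ℕ, 0 < q ∧ ∀ n : ℤ × ℤ, 0 ≤ n.2 → x (n + ((q : ℤ), 0)) = x n := by
  classical
  set S₁ := S.filter fun v => a v ≠ 0 with hS₁
  obtain ⟨v₁, hv₁, hmax⟩ := S₁.exists_max_image Prod.snd (by
    obtain ⟨v, hv, hav⟩ := ha
    exact ⟨v, Finset.mem_filter.2 ⟨hv, hav⟩⟩)
  rw [hS₁, Finset.mem_filter] at hv₁
  set T₁ := v₁.2 with hT₁
  obtain ⟨Q, hQ, H⟩ := exists_recurrence_period
    ((S₁.filter fun s => s.2 = T₁).image Prod.fst) (fun i => a (i, T₁))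
    ⟨v₁.1, Finset.mem_image_of_mem _ (Finset.mem_filter.2 ⟨Finset.mem_filter.2 hv₁, rfl⟩), hv₁.2⟩
    (2 * B)
  -- `Q` depends only on the top row of the support of `a` and on `B`, so one `q` works for all
  -- rows.
  set q := q₀ * Q with hq
  refine ⟨q, Nat.mul_pos hq₀ hQ, ?_⟩
  have key : ∀ d : ℕ, ∀ m : ℤ, b - T ≤ m → m < d →
      Function.Periodic (fun t : ℤ => x (t, m)) (q : ℤ) := by
    intro d
    induction d with
    | zero =>
      intro m hm1 hm2
      have := (hx m (Finset.mem_Ico.2 ⟨hm1, by simpa using hm2⟩)).nat_mul Q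
      simpa [hq, mul_comm] using this
    | succ d ih =>
      intro m hm1 hm2
      by_cases hmd : m < d
      · exact ih m hm1 hmd
      have hmd' : m = d := by push_cast at hm2; omega
      -- Rows below `m` are `q`-periodic and cancel from the difference of two relations, leaving a
      -- homogeneous recurrence for `u` on a single row.
      let u : ℤ → ℤ := fun i => e (x (i + q, m)) - e (x (i, m))
      have hu : ∀ t, |u t| ≤ ((2 * B : ℕ) : ℤ) := fun t => by
        have h1 := abs_le.1 (hB (x (t + q, m)))
        have h2 := abs_le.1 (hB (x (t, m)))
        rw [abs_le]
        push_cast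
        simp only [u]
        constructor <;> linarith
      have hrec : ∀ t, ∑ i ∈ (S₁.filter fun s => s.2 = T₁).image Prod.fst,
          a (i, T₁) * u (t + i) = 0 := by
        intro t
        have h1 := hrel (t + q, m - T₁)
        rw [← hrel (t, m - T₁), ← sub_eq_zero, ← Finset.sum_sub_distrib] at h1
        rw [← h1, Finset.sum_image]
        · refine Finset.sum_subset_zero_on_sdiff ((Finset.filter_subset _ _).trans
            (Finset.filter_subset _ _)) (fun v hv => ?_) (fun v hv => ?_)
          · rw [Finset.mem_sdiff, Finset.mem_filter] at hv
            by_cases hav : a v = 0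
            · rw [hav, zero_mul, zero_mul, sub_zero]
            have hvS₁ : v ∈ S₁ := Finset.mem_filter.2 ⟨hv.1, hav⟩
            have hvT : v.2 ≠ T₁ := fun h => hv.2 ⟨hvS₁, h⟩
            have hvT' : v.2 ≤ T₁ := hmax v hvS₁
            have h2 := hT v hv.1
            have h3 := hT v₁ hv₁.1
            have h4 := ih (v.2 + (m - T₁)) (by omega) (by omega) (v.1 + t)
            simp only [shift]
            rw [show v + (t + (q : ℤ), m - T₁) = (v.1 + t + q, v.2 + (m - T₁)) by
                ext <;> simp [add_assoc],
              show v + (t, m - T₁) = (v.1 + t, v.2 + (m - T₁)) by ext <;> simp]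
            simp only at h4
            rw [h4, sub_self]
          · have hvT := (Finset.mem_filter.1 hv).2
            rw [show (v.1, T₁) = v from Prod.ext rfl hvT.symm, ← mul_sub]
            simp only [u, shift]
            rw [show v + (t + (q : ℤ), m - T₁) = (t + v.1 + q, m) by
                ext <;> simp only [Prod.fst_add, Prod.snd_add] <;> omega,
              show v + (t, m - T₁) = (t + v.1, m) by
                ext <;> simp only [Prod.fst_add, Prod.snd_add] <;> omega]
        · intro v hv w hw hvw
          exact Prod.ext hvw ((Finset.mem_filter.1 hv).2.trans (Finset.mem_filter.1 hw).2.symm)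
      have huQ : Function.Periodic u (Q : ℤ) := H u 0 hu hrec
      have huq : ∀ i, u (i + q) = u i := by
        have := huQ.nat_mul q₀
        intro i
        have := this i
        simpa [hq] using this
      -- `u` is itself a `q`-difference with period `q`; boundedness turns this vanishing second
      -- difference into a vanishing first one, so the period does not grow from row to row.
      have hdd : diff ((q : ℤ), 0) (diff ((q : ℤ), 0) fun n => e (x (n.1, m))) = 0 := by
        funext n
        have := huq n.1
        simp only [u] at this
        simp only [diff, Prod.fst_add, Pi.zero_apply]
        linarith
      have hd := diff_eq_zero_of_diff_diff (fun n => hB _) hdd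
      intro t
      have := congrFun hd (t, 0)
      simp only [diff, Prod.fst_add, Pi.zero_apply] at this
      exact he (sub_eq_zero.1 this)
  intro n hn
  by_cases hbT : b - T ≤ n.2
  · have := key (n.2.toNat + 1) n.2 hbT (by omega) n.1
    simpa [Prod.add_def] using this
  · obtain ⟨v, hv, -⟩ := ha
    have := hT v hv
    omega

/-- The hypothesis on row lengths and convexity make every row of `S` at most one cell shorter than
the top row. The strict bound on the patterns below the top row makes up for this one cell, so each
row of the strip has few enough patterns to be periodic. -/
theorem IsGenerating.exists_isPeriodic [Finite A] [TopologicalSpace A] [DiscreteTopology A]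
    (hX : IsMinimalSubshift X) (hS : IsGenerating X S) {e : A → ℤ} (he : Function.Injective e)
    {B : ℕ} (hB : ∀ a, |e a| ≤ B) {T b : ℤ} (hT : ∀ s ∈ S, b ≤ s.2 ∧ s.2 ≤ T)
    (hne : (S.filter fun s => s.2 = T).Nonempty)
    (hcard : (S.filter fun s => s.2 = T).card ≤ (S.filter fun s => s.2 = b).card)
    (h : AsymptoticBelow X) : ∃ x ∈ X, IsPeriodic x := by
  classical
  have hends : ∀ j : ℤ, (S.filter fun s => s.2 = j).Nonempty → ∃ l r : ℤ, (l, j) ∈ S ∧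
      (r, j) ∈ S ∧ (∀ s ∈ S, s.2 = j → l ≤ s.1 ∧ s.1 ≤ r) ∧
      l + (((S.filter fun s => s.2 = j).card - 1 : ℕ) : ℤ) ≤ r := by
    intro j hj
    obtain ⟨vl, hvl, hl⟩ := (S.filter fun s => s.2 = j).exists_min_image Prod.fst hj
    obtain ⟨vr, hvr, hr⟩ := (S.filter fun s => s.2 = j).exists_max_image Prod.fst hj
    have hlr : ∀ s ∈ S, s.2 = j → vl.1 ≤ s.1 ∧ s.1 ≤ vr.1 := fun s hs hsj =>
      ⟨hl s (Finset.mem_filter.2 ⟨hs, hsj⟩), hr s (Finset.mem_filter.2 ⟨hs, hsj⟩)⟩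
    rw [Finset.mem_filter] at hvl hvr
    refine ⟨vl.1, vr.1, ?_, ?_, hlr, ?_⟩
    · rw [← hvl.2]; exact hvl.1
    · rw [← hvr.2]; exact hvr.1
    · have hsub : (S.filter fun s => s.2 = j) ⊆
          (Finset.Icc vl.1 vr.1).image fun i => (i, j) := by
        intro s hs
        rw [Finset.mem_filter] at hs
        exact Finset.mem_image.2 ⟨s.1, Finset.mem_Icc.2 (hlr s hs.1 hs.2), Prod.ext rfl hs.2.symm⟩
      have h1 := (Finset.card_le_card hsub).trans Finset.card_image_le
      rw [Int.card_Icc] at h1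
      have h2 := (hlr _ hvr.1 hvr.2).1
      omega
  have hpos := Finset.card_pos.2 hne
  obtain ⟨l, r, hl, hr, hlr, hlen⟩ := hends T hne
  obtain ⟨l', r', hl', hr', -, hlen'⟩ := hends b (Finset.card_pos.1 (by omega))
  obtain ⟨x, hx, y, hy, hbelow, i₀, hi₀⟩ := h.exists_ne_row hX
  have hlt := hS.ncard_patternSet_lt hX (fun s hs => (hT s hs).2) hl hr hlr hx hy hbelow hi₀
  have hrows : ∀ j ∈ Finset.Ico (b - T) 0, ∃ Q : ℕ, 0 < Q ∧ ∀ t, x (t + Q, j) = x (t, j) := by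
    intro j hj
    rw [Finset.mem_Ico] at hj
    have h1 := hS.convex.le_card_row hl hr hl' hr' (j := j + T)
      (len := (S.filter fun s => s.2 = T).card - 1) hlen (by omega) (by omega) (by omega)
    have h2 : (S.filter fun s => s.2 = j + T) ⊆ S.filter fun s => s.2 ≠ T := fun s hs => by
      rw [Finset.mem_filter] at hs ⊢
      exact ⟨hs.1, by omega⟩
    have h3 := ncard_patternSet_mono (X := Set.range fun t : ℤ => shift (t, -T) x) h2
    have := exists_row_period he hB x T (j + T) (S := S) (by omega)
    simpa using this
  obtain ⟨q₀, hq₀, hper⟩ := exists_common_row_period x _ hrows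
  obtain ⟨a, κ, ha, hrel⟩ := exists_relation e X hX.nonempty S hS.ncard_le
  obtain ⟨q, hq, hqx⟩ := exists_period_above he hB hT ha
    (fun t => hrel _ (hX.shift_mem t x hx)) hq₀ hper
  -- Upward shifts let the periodic upper half-plane exhaust the grid.
  obtain ⟨x', hx'⟩ := exists_ultralimit (hyperfilter ℕ) fun m : ℕ => shift (0, (m : ℤ)) x
  refine ⟨x', mem_of_ultralimit hX.isClosed (fun m => hX.shift_mem _ _ hx) hx',
    isPeriodic_of_shift_eq (t := ((q : ℤ), 0)) ?_ ?_⟩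
  · simp [Prod.ext_iff, hq.ne']
  · funext n
    have hlarge : ∀ᶠ m : ℕ in hyperfilter ℕ, (-n.2).toNat ≤ m := by
      refine hyperfilter_le_cofinite ?_
      rw [Nat.cofinite_eq_atTop]
      exact eventually_ge_atTop _
    obtain ⟨m, h1, h2, h3⟩ := ((hx' n).and ((hx' (n + ((q : ℤ), 0))).and hlarge)).exists
    change x' (n + ((q : ℤ), 0)) = x' n
    rw [← h1, ← h2]
    change x (n + ((q : ℤ), 0) + (0, (m : ℤ))) = x (n + (0, (m : ℤ)))
    rw [add_right_comm]
    exact hqx _ (by simp only [Prod.snd_add]; omega)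

end Strip


/-! ### Changes of lattice coordinates -/

section Reindex

variable {A : Type*}

/-- The set of configurations of `X` in the coordinates given by `g`. -/
def reindex (g : ℤ × ℤ ≃+ ℤ × ℤ) (X : Set (Config A)) : Set (Config A) :=
  {x | (fun n => x (g.symm n)) ∈ X}

theorem mem_reindex_of_mem (g : ℤ × ℤ ≃+ ℤ × ℤ) {X : Set (Config A)} {x : Config A} (hx : x ∈ X) :
    (fun n => x (g n)) ∈ reindex g X := by
  change (fun n => x (g (g.symm n))) ∈ X
  simpa using hx

theorem IsMinimalSubshift.reindex [TopologicalSpace A] {X : Set (Config A)}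
    (hX : IsMinimalSubshift X) (g : ℤ × ℤ ≃+ ℤ × ℤ) : IsMinimalSubshift (reindex g X) where
  nonempty := by
    obtain ⟨x, hx⟩ := hX.nonempty
    exact ⟨_, mem_reindex_of_mem g hx⟩
  isClosed := hX.isClosed.preimage (continuous_pi fun _ => continuous_apply _)
  shift_mem := by
    intro t x hx
    have := hX.shift_mem (g t) _ hx
    change (fun n => x (g.symm n + t)) ∈ X
    convert this using 1
    funext n
    simp [shift]
  recurrent := by
    classical
    intro x hx y hy F
    obtain ⟨t, ht⟩ := hX.recurrent _ hx _ hy (F.image g)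
    refine ⟨g.symm t, fun n hn => ?_⟩
    simpa using ht (g n) (Finset.mem_image_of_mem g hn)

theorem exists_isPeriodic_of_reindex {X : Set (Config A)} (g : ℤ × ℤ ≃+ ℤ × ℤ)
    (h : ∃ x ∈ reindex g X, IsPeriodic x) : ∃ x ∈ X, IsPeriodic x := by
  obtain ⟨x, hx, hper⟩ := h
  obtain ⟨t, ht, h⟩ := hper.exists_shift_eq
  refine ⟨_, hx, isPeriodic_of_shift_eq (t := g t) (by simpa using ht) ?_⟩
  funext n
  have := congrFun h (g.symm n)
  simpa [shift] using this

theorem ncard_patternSet_reindex (g : ℤ × ℤ ≃+ ℤ × ℤ) (X : Set (Config A))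
    (S : Finset (ℤ × ℤ)) :
    (patternSet (reindex g X) S).ncard = (patternSet X (S.map g.toEquiv.toEmbedding)).ncard := by
  have hmem : ∀ s : S, g s ∈ S.map g.toEquiv.toEmbedding := fun s =>
    Finset.mem_map_of_mem _ s.2
  rw [← Set.ncard_image_of_injective (patternSet X (S.map g.toEquiv.toEmbedding))
    (f := fun (q : ↥(S.map g.toEquiv.toEmbedding) → A) (s : S) =>
      q ⟨g s, hmem s⟩)]
  · congr 1
    ext q
    constructor
    · rintro ⟨x, hx, rfl⟩
      refine ⟨_, ⟨_, hx, rfl⟩, ?_⟩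
      funext s
      simp
    · rintro ⟨_, ⟨x, hx, rfl⟩, rfl⟩
      exact ⟨_, mem_reindex_of_mem g hx, rfl⟩
  · intro q q' h
    funext ⟨s, hs⟩
    obtain ⟨s', hs', rfl⟩ := Finset.mem_map.1 hs
    exact congrFun h ⟨s', hs'⟩

theorem IntConvex.map {S : Finset (ℤ × ℤ)} (hS : IntConvex S) (g : ℤ × ℤ ≃+ ℤ × ℤ) :
    IntConvex (S.map g.toEquiv.toEmbedding) := by
  have hlin : ∀ p : ℤ × ℤ, g.symm p = p.1 • g.symm (1, 0) + p.2 • g.symm (0, 1) := by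
    intro p
    rw [← map_zsmul, ← map_zsmul, ← map_add]
    congr 1
    ext <;> simp
  intro p hp
  have hp' : g.symm p ∉ S := fun h => hp (by
    have := Finset.mem_map_of_mem g.toEquiv.toEmbedding h
    simpa using this)
  obtain ⟨α, β, γ, h1, h2⟩ := hS _ hp'
  have hform : ∀ p : ℤ × ℤ, (α * (g.symm (1, 0)).1 + β * (g.symm (1, 0)).2) * p.1 +
      (α * (g.symm (0, 1)).1 + β * (g.symm (0, 1)).2) * p.2 =
      α * (g.symm p).1 + β * (g.symm p).2 := by
    intro p
    rw [hlin p]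
    simp only [Prod.fst_add, Prod.snd_add, Prod.smul_fst, Prod.smul_snd, smul_eq_mul]
    ring
  refine ⟨_, _, γ, by rw [hform]; exact h1, fun s hs => ?_⟩
  rw [hform]
  obtain ⟨s', hs', rfl⟩ := Finset.mem_map.1 hs
  simpa using h2 s' hs'

theorem map_symm_map (g : ℤ × ℤ ≃+ ℤ × ℤ) (S : Finset (ℤ × ℤ)) :
    (S.map g.symm.toEquiv.toEmbedding).map g.toEquiv.toEmbedding = S := by
  ext s
  simp

theorem IsGenerating.reindex {X : Set (Config A)} {S : Finset (ℤ × ℤ)} (hS : IsGenerating X S)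
    (g : ℤ × ℤ ≃+ ℤ × ℤ) :
    IsGenerating (reindex g X) (S.map g.symm.toEquiv.toEmbedding) where
  convex := hS.convex.map g.symm
  ncard_le := by
    rw [ncard_patternSet_reindex, map_symm_map, Finset.card_map]
    exact hS.ncard_le
  lt_ncard := by
    intro S' hcard hS'
    rw [Finset.card_map] at hcard
    have := hS.lt_ncard (S'.map g.toEquiv.toEmbedding) (by rwa [Finset.card_map]) (hS'.map g)
    rwa [Finset.card_map, ← ncard_patternSet_reindex] at this

/-- The reflection of the grid at the horizontal axis. -/
def reflection : ℤ × ℤ ≃+ ℤ × ℤ := AddEquiv.prodCongr (AddEquiv.refl ℤ) (AddEquiv.neg ℤ)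

theorem reflection_apply (n : ℤ × ℤ) : reflection n = (n.1, -n.2) := rfl

theorem reflection_symm_apply (n : ℤ × ℤ) : reflection.symm n = (n.1, -n.2) := rfl

theorem AsymptoticAbove.reindex_reflection {X : Set (Config A)} (h : AsymptoticAbove X) :
    AsymptoticBelow (reindex reflection X) := by
  obtain ⟨x, hx, y, hy, hxy, habove⟩ := h
  refine ⟨_, mem_reindex_of_mem _ hx, _, mem_reindex_of_mem _ hy, fun heq => hxy ?_, fun n hn => ?_⟩
  · funext n
    simpa using congrFun heq (reflection.symm n)
  · exact habove _ (by rw [reflection_apply]; simpa using hn)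

end Reindex

/-! ### Assembling the proof -/

section Main

variable {A : Type*}

/-- The configurations of a low complexity subshift are annihilated by a common product of
difference operators. -/
theorem exists_diffs_eq_zero_of_ncard_le [Finite A] [TopologicalSpace A] {X : Set (Config A)}
    (hX : IsMinimalSubshift X) {S : Finset (ℤ × ℤ)} (hS : (patternSet X S).ncard ≤ S.card)
    (e : A → ℤ) {B : ℕ} (hB : ∀ a, |e a| ≤ B) :
    ∃ W : List (ℤ × ℤ), (∀ w ∈ W, w ≠ 0) ∧ ∀ x ∈ X, diffs W (fun n => e (x n)) = 0 := by
  obtain ⟨a, κ, ⟨v, hv, hav⟩, hrel⟩ := exists_relation e X hX.nonempty S hS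
  -- The extra difference in direction `(1, 0)` kills the constant `κ` and doubles the bound.
  obtain ⟨W, hW, H⟩ := exists_diffs_eq_zero S a hv hav (2 * B)
  refine ⟨(1, 0) :: W, fun w hw => ?_, fun x hx => ?_⟩
  · rcases List.mem_cons.1 hw with rfl | hw
    · simp [Prod.ext_iff]
    · exact hW w hw
  · rw [diffs_cons, ← diffs_diff]
    refine H _ (fun n => ?_) fun n => ?_
    · have h1 := abs_le.1 (hB (x (n + (1, 0))))
      have h2 := abs_le.1 (hB (x n))
      rw [abs_le]
      simp only [diff]
      constructor <;> linarith
    · have h1 := hrel _ (hX.shift_mem (n + (1, 0)) x hx)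
      rw [← hrel _ (hX.shift_mem n x hx), ← sub_eq_zero, ← Finset.sum_sub_distrib] at h1
      refine Eq.trans (Finset.sum_congr rfl fun v _ => ?_) h1
      rw [← mul_sub]
      change a v * (e (x (n + v + (1, 0))) - e (x (n + v))) =
        a v * (e (x (v + (n + (1, 0)))) - e (x (v + n)))
      rw [add_comm v n, add_comm v (n + (1, 0)), add_right_comm]

theorem exists_injective_bounded (A : Type*) [Finite A] :
    ∃ (e : A → ℤ) (B : ℕ), Function.Injective e ∧ ∀ a, |e a| ≤ B := by
  obtain ⟨m, ⟨f⟩⟩ := Finite.exists_equiv_fin A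
  refine ⟨fun a => (f a : ℕ), m, fun a b h => f.injective (Fin.ext (Int.ofNat_inj.1 h)),
    fun a => ?_⟩
  change |((f a : ℕ) : ℤ)| ≤ m
  rw [abs_of_nonneg (by positivity)]
  exact_mod_cast (f a).2.le

theorem intConvex_rectangle (n m : ℕ) : IntConvex (rectangle n m) := by
  intro p hp
  simp only [rectangle, Finset.mem_product, Finset.mem_Icc] at hp ⊢
  by_cases h1 : 1 ≤ p.1
  · by_cases h2 : p.1 ≤ n
    · by_cases h3 : 1 ≤ p.2
      · exact ⟨0, 1, m, by omega, fun s hs => by omega⟩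
      · exact ⟨0, -1, -1, by omega, fun s hs => by omega⟩
    · exact ⟨1, 0, n, by omega, fun s hs => by omega⟩
  · exact ⟨-1, 0, -1, by omega, fun s hs => by omega⟩

theorem shift_mem_orbitClosure [TopologicalSpace A] {c x : Config A} (t : ℤ × ℤ) (hx : x ∈ orbitClosure c) :
    shift t x ∈ orbitClosure c := by
  have := image_closure_subset_closure_image (continuous_shift (A := A) t) ⟨x, hx, rfl⟩
  refine closure_mono ?_ this
  rintro _ ⟨_, ⟨s, rfl⟩, rfl⟩
  refine ⟨s - t, ?_⟩
  funext n
  simp only [shift, translate]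
  congr 1
  abel

theorem patternSet_orbitClosure_subset [TopologicalSpace A] [DiscreteTopology A] (c : Config A) (D : Finset (ℤ × ℤ)) :
    patternSet (orbitClosure c) D ⊆ patterns c D := by
  rintro _ ⟨x, hx, rfl⟩
  have hcont : Continuous fun (y : Config A) (s : D) => y s :=
    continuous_pi fun _ => continuous_apply _
  have hopen : (fun (y : Config A) (s : D) => y s) ⁻¹' {fun s : D => x s} ∈ 𝓝 x :=
    hcont.continuousAt.preimage_mem_nhds (by simp [nhds_discrete])
  obtain ⟨_, hz, t, rfl⟩ := mem_closure_iff_nhds.1 hx _ hopen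
  exact ⟨t, hz.symm⟩

variable [Finite A] [TopologicalSpace A] [DiscreteTopology A] {X : Set (Config A)}

/-- Pairs asymptotic below have periodic differences, so pairs asymptotic above exist too. Whichever
of the top and bottom rows of a generating set is the shorter, a pair suited to that side is
available. -/
theorem exists_isPeriodic_of_asymptoticBelow (hX : IsMinimalSubshift X) {D : Finset (ℤ × ℤ)}
    (hD : IntConvex D) (hcard : (patternSet X D).ncard ≤ D.card) (h : AsymptoticBelow X) :
    ∃ x ∈ X, IsPeriodic x := by
  classical
  obtain ⟨e, B, he, hB⟩ := exists_injective_bounded A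
  obtain ⟨W, hW, hWX⟩ := exists_diffs_eq_zero_of_ncard_le hX hcard e hB
  let L : ℤ × ℤ →+ ℝ := (Int.castAddHom ℝ).comp (AddMonoidHom.snd ℤ ℤ)
  have hL : ∀ n, L n = n.2 := fun n => rfl
  obtain ⟨p, hp, hpW⟩ := exists_horizontal_period (W.filter fun w => L w = 0) fun w hw => by
    rw [List.mem_filter, decide_eq_true_iff, hL] at hw
    exact ⟨hW w hw.1, by exact_mod_cast hw.2⟩
  have hper : ∀ x ∈ X, ∀ y ∈ X, (∀ n : ℤ × ℤ, n.2 < 0 → x n = y n) → PeriodicDiff e p x y := by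
    intro x hx y hy hxy n
    have h0 : diffs W ((fun n => e (x n)) - fun n => e (y n)) = 0 := by
      rw [diffs_sub, hWX x hx, hWX y hy, sub_zero]
    have h1 := diffs_filter_eq_zero L W _ 0 (fun n hn => by
      rw [Pi.sub_apply, hxy n (by rw [hL] at hn; exact_mod_cast hn), sub_self]) h0
    have h2 := congrFun (hpW _ (2 * B) (fun n => by
      have h1 := abs_le.1 (hB (x n))
      have h2 := abs_le.1 (hB (y n))
      rw [abs_le, Pi.sub_apply]
      push_cast
      constructor <;> linarith) h1) n
    simp only [diff, Pi.sub_apply, Pi.zero_apply] at h2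
    linarith
  have habove := h.above hX he hp hper
  obtain ⟨S, hS⟩ := exists_isGenerating hD hcard
  have hne := hS.nonempty hX.nonempty
  obtain ⟨vT, hvT, hT⟩ := S.exists_max_image Prod.snd hne
  obtain ⟨vb, hvb, hb⟩ := S.exists_min_image Prod.snd hne
  rcases le_total (S.filter fun s => s.2 = vT.2).card (S.filter fun s => s.2 = vb.2).card with
    hle | hle
  · exact hS.exists_isPeriodic hX he hB (fun s hs => ⟨hb s hs, hT s hs⟩)
      ⟨vT, Finset.mem_filter.2 ⟨hvT, rfl⟩⟩ hle h
  · refine exists_isPeriodic_of_reindex reflection ?_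
    have hrow : ∀ j : ℤ, ((S.map reflection.symm.toEquiv.toEmbedding).filter
        fun s => s.2 = -j) = (S.filter fun s => s.2 = j).map
          reflection.symm.toEquiv.toEmbedding := by
      intro j
      rw [Finset.filter_map]
      congr 1
      refine Finset.filter_congr fun s _ => ?_
      simp [reflection_symm_apply]
    refine (hS.reindex reflection).exists_isPeriodic (hX.reindex reflection) he hB
      (T := -vb.2) (b := -vT.2) (fun s hs => ?_) ?_ ?_ habove.reindex_reflection
    · obtain ⟨s', hs', rfl⟩ := Finset.mem_map.1 hs
      have h1 := hb s' hs'
      have h2 := hT s' hs'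
      simp [reflection_symm_apply, h1, h2]
    · rw [hrow, Finset.map_nonempty]
      exact ⟨vb, Finset.mem_filter.2 ⟨hvb, rfl⟩⟩
    · rw [hrow, hrow, Finset.card_map, Finset.card_map]
      exact hle

/-- Coordinates in which a given integer vector is horizontal. -/
theorem exists_addEquiv_snd_eq_zero {w : ℤ × ℤ} (hw : w ≠ 0) :
    ∃ g : ℤ × ℤ ≃+ ℤ × ℤ, (g.symm w).2 = 0 := by
  have hd : 0 < Int.gcd w.1 w.2 := Int.gcd_pos_iff.2 (by
    by_contra! h
    exact hw (Prod.ext h.1 h.2))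
  obtain ⟨v₁, hv₁⟩ := Int.gcd_dvd_left w.1 w.2
  obtain ⟨v₂, hv₂⟩ := Int.gcd_dvd_right w.1 w.2
  have hbez := Int.gcd_eq_gcd_ab w.1 w.2
  set a := Int.gcdA w.1 w.2
  set b := Int.gcdB w.1 w.2
  set d : ℤ := (Int.gcd w.1 w.2 : ℤ)
  have hdet : v₁ * a + v₂ * b = 1 := by
    have hd0 : d ≠ 0 := by omega
    apply mul_left_cancel₀ hd0
    linear_combination -hbez - a * hv₁ - b * hv₂
  -- The primitive vector `(v₁, v₂)` along `w` is completed to a basis by the Bézout coefficients;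
  -- the determinant is `1`.
  refine ⟨{ toFun := fun n => (v₁ * n.1 - b * n.2, v₂ * n.1 + a * n.2)
            invFun := fun n => (a * n.1 + b * n.2, -v₂ * n.1 + v₁ * n.2)
            left_inv := fun n => ?_
            right_inv := fun n => ?_
            map_add' := fun m n => ?_ }, ?_⟩
  · ext
    · linear_combination n.1 * hdet
    · linear_combination n.2 * hdet
  · ext
    · linear_combination n.1 * hdet
    · linear_combination n.2 * hdet
  · ext <;> simp only [Prod.fst_add, Prod.snd_add] <;> ring
  · change -v₂ * w.1 + v₁ * w.2 = 0
    linear_combination -v₂ * hv₁ + v₁ * hv₂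

/-- The half-plane from compactness may have any real slope. If no operator in `W` were parallel to
its boundary, all would cancel and the pair would coincide; a parallel `w` makes the slope rational
and becomes the horizontal direction. -/
theorem exists_isPeriodic_of_ncard_le (hX : IsMinimalSubshift X) {D : Finset (ℤ × ℤ)}
    (hD : IntConvex D) (hcard : (patternSet X D).ncard ≤ D.card) : ∃ x ∈ X, IsPeriodic x := by
  classical
  by_cases hf : X.Finite
  · exact exists_isPeriodic_of_finite hX hf
  obtain ⟨L, hL, x, hx, y, hy, hxy, hhalf⟩ := exists_asymptotic_pair hX hf
  obtain ⟨e, B, he, hB⟩ := exists_injective_bounded A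
  obtain ⟨W, hW, hWX⟩ := exists_diffs_eq_zero_of_ncard_le hX hcard e hB
  have h0 : diffs W ((fun n => e (x n)) - fun n => e (y n)) = 0 := by
    rw [diffs_sub, hWX x hx, hWX y hy, sub_zero]
  have h1 := diffs_filter_eq_zero L W _ 0 (fun n hn => by
    rw [Pi.sub_apply, hhalf n hn, sub_self]) h0
  obtain ⟨w, hw⟩ : ∃ w, w ∈ W.filter fun w => L w = 0 := by
    refine List.exists_mem_of_ne_nil _ fun hnil => hxy ?_
    rw [hnil] at h1
    funext n
    exact he (sub_eq_zero.1 (congrFun h1 n))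
  rw [List.mem_filter, decide_eq_true_iff] at hw
  obtain ⟨g, hg⟩ := exists_addEquiv_snd_eq_zero (hW w hw.1)
  have hw1 : (g.symm w).1 ≠ 0 := fun h => hW w hw.1 (by
    have : g.symm w = 0 := Prod.ext h hg
    simpa using this)
  have hlin : ∀ n : ℤ × ℤ, L (g n) = n.1 * L (g (1, 0)) + n.2 * L (g (0, 1)) := by
    intro n
    have : n = n.1 • ((1, 0) : ℤ × ℤ) + n.2 • ((0, 1) : ℤ × ℤ) := by ext <;> simp
    conv_lhs => rw [this, map_add, map_add, map_zsmul, map_zsmul, map_zsmul, map_zsmul,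
      zsmul_eq_mul, zsmul_eq_mul]
  have h10 : L (g (1, 0)) = 0 := by
    have h2 := hlin (g.symm w)
    rw [AddEquiv.apply_symm_apply, hw.2, hg, Int.cast_zero, zero_mul, add_zero] at h2
    exact (mul_eq_zero.1 h2.symm).resolve_left (by exact_mod_cast hw1)
  set μ := L (g (0, 1)) with hμ
  have hLg : ∀ n : ℤ × ℤ, L (g n) = n.2 * μ := fun n => by rw [hlin, h10, mul_zero, zero_add]
  have hμ0 : μ ≠ 0 := fun h => hL (by
    ext n
    rw [← g.apply_symm_apply n, hLg, h, mul_zero]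
    rfl)
  have hcard' : (patternSet (reindex g X) (D.map g.symm.toEquiv.toEmbedding)).ncard ≤
      (D.map g.symm.toEquiv.toEmbedding).card := by
    rwa [ncard_patternSet_reindex, map_symm_map, Finset.card_map]
  have hxy' : (fun n => x (g n)) ≠ fun n => y (g n) := fun heq => hxy (by
    funext n
    simpa using congrFun heq (g.symm n))
  refine exists_isPeriodic_of_reindex g ?_
  rcases lt_or_gt_of_ne hμ0 with hneg | hpos
  · have habove : AsymptoticAbove (reindex g X) :=
      ⟨_, mem_reindex_of_mem g hx, _, mem_reindex_of_mem g hy, hxy', fun n hn => hhalf _ (by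
        rw [hLg]
        exact mul_neg_of_pos_of_neg (by exact_mod_cast hn) hneg)⟩
    refine exists_isPeriodic_of_reindex reflection ?_
    refine exists_isPeriodic_of_asymptoticBelow ((hX.reindex g).reindex reflection)
      ((hD.map g.symm).map reflection.symm) ?_ habove.reindex_reflection
    rwa [ncard_patternSet_reindex, map_symm_map, Finset.card_map]
  · exact exists_isPeriodic_of_asymptoticBelow (hX.reindex g) (hD.map g.symm) hcard'
      ⟨_, mem_reindex_of_mem g hx, _, mem_reindex_of_mem g hy, hxy', fun n hn => hhalf _ (by
        rw [hLg]
        exact mul_neg_of_neg_of_pos (by exact_mod_cast hn) hpos)⟩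

end Main

end Grid

theorem theorem2 {A : Type*} [Finite A] [TopologicalSpace A] [DiscreteTopology A]
    (c : Grid.Config A) (n m : ℕ) (hc : Grid.LowComplexity c (Grid.rectangle n m)) :
    ∃ c' ∈ Grid.orbitClosure c, Grid.IsPeriodic c' := by
  obtain ⟨X, hXc, hX⟩ := Grid.exists_minimalSubshift (Grid.orbitClosure c)
    ⟨c, subset_closure ⟨0, by funext n; simp [Grid.translate]⟩⟩ isClosed_closure
    fun t x hx => Grid.shift_mem_orbitClosure t hx
  have hsub : Grid.patternSet X (Grid.rectangle n m) ⊆ Grid.patterns c (Grid.rectangle n m) :=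
    (Set.image_mono hXc).trans (Grid.patternSet_orbitClosure_subset c _)
  have hcard : (Grid.patternSet X (Grid.rectangle n m)).ncard ≤ (Grid.rectangle n m).card := by
    have h := (Set.encard_le_encard hsub).trans hc
    rw [← (Set.toFinite _).cast_ncard_eq] at h
    exact_mod_cast h
  obtain ⟨x, hx, hper⟩ :=
    Grid.exists_isPeriodic_of_ncard_le hX (Grid.intConvex_rectangle n m) hcard
  exact ⟨x, hXc hx, hper⟩
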